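/- Let $d,n\ge 1$, let $x_0\in\mathbb{R}^d$ and let $x_1,\dots,x_n\in\mathbb{R}^d$ be distinct, ordered so that $\|x_1-x_0\|\le\dots\le\|x_n-x_0\|$ (Euclidean norm), with $x_1\ne x_0$ and $\|x_1-x_0\|<\|x_j-x_0\|$ for all $j\ge2$. Let $C\ge0$ and $\sigma_1,\dots,\sigma_n>0$ be known, and put $k_j:=C\|x_j-x_0\|$. Let $\Theta$ be the set of all $C$-Lipschitz functions $\theta:\mathbb{R}^d\to\mathbb{R}$. The data are $Y=(Y_1,\dots,Y_n)^\top\sim N(m(\theta),\Sigma)$ with $m(\theta)=(\theta(x_1),\dots,\theta(x_n))^\top$ and $\Sigma=\operatorname{diag}(\sigma_1^2,\dots,\sigma_n^2)$; write $\mathbb{E}_{m(\theta)}$ for the expectation under this law. A decision rule is a measurable map $\delta:\mathbb{R}^n\to[0,1]$; its expected regret at $\theta\in\Theta$ is $$R(\delta,\theta)=\theta(x_0)\bigl(\mathbf{1}\{\theta(x_0)\ge0\}-\mathbb{E}_{m(\theta)}[\delta(Y)]\bigr).$$ A decision rule $\delta^*$ is minimax regret (MMR) optimal if $\sup_{\theta\in\Theta}R(\delta^*,\theta)=\inf_\delta\sup_{\theta\in\Theta}R(\delta,\theta)$,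 the infimum being over all decision rules. Let $\Phi$ and $\phi$ be the standard normal distribution function and density. Then the following hold. (i) Suppose $C\|x_1-x_0\|<\sqrt{\pi/2}\,\sigma_1$. There is exactly one $m_0^*>k_1$ with $$\frac{\Phi(-s)}{\phi(-s)}=\frac{m_0^*}{s}\sum_{j=1}^n\frac{\max\{m_0^*-k_j,0\}}{\sigma_j^2},\qquad s:=\sqrt{\sum_{j=1}^n\frac{\max\{m_0^*-k_j,0\}^2}{\sigma_j^2}}.$$ With $$w_{m_0^*}^\top:=\left(1,\frac{\max\{m_0^*-k_2,0\}/\sigma_2^2}{(m_0^*-k_1)/\sigma_1^2},\dots,\frac{\max\{m_0^*-k_n,0\}/\sigma_n^2}{(m_0^*-k_1)/\sigma_1^2}\right),$$ the rule $\mathbf{1}\{w_{m_0^*}^\top Y\ge0\}$ is MMR optimal, and every MMR optimal rule agrees with it almost surely under the law of $Y$ for every $\theta\in\Theta$. (ii) If $C\|x_1-x_0\|=\sqrt{\pi/2}\,\sigma_1$, then $\mathbf{1}\{Y_1\ge0\}$ is MMR optimal. (iii) Suppose $C\|x_1-x_0\|>\sqrt{\pi/2}\,\sigma_1$. There is exactly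 one $\rho^*\in(0,C\|x_1-x_0\|)$ with $$\rho^*=C\|x_1-x_0\|\bigl(1-2\Phi(-\rho^*/\sigma_1)\bigr).$$ The rule $$d^*_{\mathrm{linear}}(Y_1)=\begin{cases}0,&Y_1<-\rho^*,\\ \dfrac{Y_1+\rho^*}{2\rho^*},&-\rho^*\le Y_1\le\rho^*,\\ 1,&Y_1>\rho^*,\end{cases}$$ is MMR optimal; so is $d^*_{\mathrm{RT}}(Y_1)=\Phi(Y_1/\tilde\sigma)$ with $\tilde\sigma=\sqrt{2C^2\|x_1-x_0\|^2/\pi-\sigma_1^2}$; and so is $t\,d^*_{\mathrm{linear}}+(1-t)\,d^*_{\mathrm{RT}}$ for every $t\in[0,1]$. (iv) If $C\|x_1-x_0\|>\sqrt{\pi/2}\,\sigma_1$, then no linear threshold rule $\mathbf{1}\{w^\top Y\ge c\}$ with $w\in\mathbb{R}^n$ and $c\in\mathbb{R}\cup\{-\infty,\infty\}$ is MMR optimal. -/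

import Mathlib

open MeasureTheory ProbabilityTheory

noncomputable section

namespace EvidenceAggregation

/-- The standard normal distribution function `Φ`. -/
def stdCdf (t : ℝ) : ℝ := cdf (gaussianReal 0 1) t

/-- The standard normal density `φ`. -/
def stdPdf (t : ℝ) : ℝ := gaussianPDFReal 0 1 t

/-- The parameter space `Θ`: all functions `θ : ℝᵈ → ℝ` that are Lipschitz with constant `C`
for the Euclidean norm. -/
def Params (d : ℕ) (C : NNReal) : Set (EuclideanSpace ℝ (Fin d) → ℝ) :=
  {θ | LipschitzWith C θ}

/-- The law `N(m(θ), Σ)` of the data `Y = (Y₁, …, Yₙ)`, where `m(θ) = (θ(x₁), …, θ(xₙ))` and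
`Σ = diag(σ₁², …, σₙ²)`. -/
def dataLaw {d n : ℕ} (x : Fin n → EuclideanSpace ℝ (Fin d)) (σ : Fin n → ℝ)
    (θ : EuclideanSpace ℝ (Fin d) → ℝ) : Measure (EuclideanSpace ℝ (Fin n)) :=
  multivariateGaussian (WithLp.toLp 2 (fun i => θ (x i))) (Matrix.diagonal (fun i => σ i ^ 2))

/-- In coordinates, the data are independent with `Y_i ~ N(θ(x_i), σ_i²)`. -/
theorem dataLaw_eq_pi {d n : ℕ} (x : Fin n → EuclideanSpace ℝ (Fin d)) (σ : Fin n → ℝ)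
    (θ : EuclideanSpace ℝ (Fin d) → ℝ) :
    dataLaw x σ θ =
      (Measure.pi (fun i => gaussianReal (θ (x i)) (σ i ^ 2).toNNReal)).map
        (WithLp.toLp 2) := by
  have hS : (Matrix.diagonal (fun i => σ i ^ 2)).PosSemidef :=
    Matrix.PosSemidef.diagonal (fun i => sq_nonneg (σ i))
  have : IsFiniteMeasure (dataLaw x σ θ) := by unfold dataLaw; infer_instance
  have : IsFiniteMeasure
      ((Measure.pi (fun i => gaussianReal (θ (x i)) (σ i ^ 2).toNNReal)).map
        (WithLp.toLp 2 : (Fin n → ℝ) → EuclideanSpace ℝ (Fin n))) :=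
    inferInstance
  apply Measure.ext_of_charFun
  ext t
  rw [charFun_pi, dataLaw, charFun_multivariateGaussian hS]
  simp_rw [charFun_gaussianReal]
  rw [← Complex.exp_sum, Finset.sum_sub_distrib]
  congr 2
  · simp [PiLp.inner_apply, Finset.mul_sum, mul_comm]
  · simp only [dotProduct, Matrix.mulVec_diagonal]
    push_cast
    rw [Finset.sum_div]
    refine Finset.sum_congr rfl (fun i _ => ?_)
    rw [Real.coe_toNNReal _ (sq_nonneg (σ i))]
    push_cast
    ring

/-- A decision rule: a measurable map from the data to the unit interval. -/
def IsDecisionRule {n : ℕ} (δ : EuclideanSpace ℝ (Fin n) → ℝ) : Prop :=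
  Measurable δ ∧ ∀ y, δ y ∈ Set.Icc (0 : ℝ) 1

/-- The expected regret `R(δ, θ) = U(θ) (1{U(θ) ≥ 0} - E_{m(θ)}[δ(Y)])`, with the welfare contrast
`U(θ) = θ(x₀)`. -/
def regret {d n : ℕ} (x₀ : EuclideanSpace ℝ (Fin d)) (x : Fin n → EuclideanSpace ℝ (Fin d))
    (σ : Fin n → ℝ) (δ : EuclideanSpace ℝ (Fin n) → ℝ) (θ : EuclideanSpace ℝ (Fin d) → ℝ) : ℝ :=
  θ x₀ * ((if 0 ≤ θ x₀ then 1 else 0) - ∫ y, δ y ∂(dataLaw x σ θ))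

/-- The worst-case expected regret `sup_{θ ∈ Θ} R(δ, θ)`, as an extended real number. -/
def maxRegret {d n : ℕ} (C : NNReal) (x₀ : EuclideanSpace ℝ (Fin d))
    (x : Fin n → EuclideanSpace ℝ (Fin d)) (σ : Fin n → ℝ)
    (δ : EuclideanSpace ℝ (Fin n) → ℝ) : EReal :=
  ⨆ θ ∈ Params d C, (regret x₀ x σ δ θ : EReal)

/-- Minimax regret optimality. -/
def IsMMR {d n : ℕ} (C : NNReal) (x₀ : EuclideanSpace ℝ (Fin d))
    (x : Fin n → EuclideanSpace ℝ (Fin d)) (σ : Fin n → ℝ)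
    (δ : EuclideanSpace ℝ (Fin n) → ℝ) : Prop :=
  IsDecisionRule δ ∧
    maxRegret C x₀ x σ δ =
      ⨅ δ' ∈ {δ' : EuclideanSpace ℝ (Fin n) → ℝ | IsDecisionRule δ'}, maxRegret C x₀ x σ δ'

/-- The linear threshold rule `1{wᵀY ≥ c}`, with `c ∈ ℝ ∪ {-∞, ∞}`. -/
def thresholdRule {n : ℕ} (w : Fin n → ℝ) (c : EReal) (y : EuclideanSpace ℝ (Fin n)) : ℝ :=
  open Classical in if c ≤ ((∑ i, w i * y i : ℝ) : EReal) then 1 else 0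

/-- The number `max{m - C‖x_j - x₀‖, 0}`. -/
def excess {d n : ℕ} (C : NNReal) (x₀ : EuclideanSpace ℝ (Fin d))
    (x : Fin n → EuclideanSpace ℝ (Fin d)) (m : ℝ) (j : Fin n) : ℝ :=
  max (m - C * ‖x j - x₀‖) 0

/-- The weight vector `w_m`; its first entry is `1` and its `j`-th entry is
`(max{m - C‖x_j - x₀‖, 0} / σ_j²) / ((m - C‖x₁ - x₀‖) / σ₁²)` for `j ≥ 2`.
(The country with number `1` has index `0 : Fin n`.) -/
def weights {d n : ℕ} [NeZero n] (C : NNReal) (x₀ : EuclideanSpace ℝ (Fin d))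
    (x : Fin n → EuclideanSpace ℝ (Fin d)) (σ : Fin n → ℝ) (m : ℝ) (j : Fin n) : ℝ :=
  if j = 0 then 1
  else (excess C x₀ x m j / σ j ^ 2) / ((m - C * ‖x 0 - x₀‖) / σ 0 ^ 2)

/-- The fixed-point equation `Φ(-s) / φ(-s) = m (∑_j max{m - C‖x_j - x₀‖, 0} / σ_j²) / s`, where
`s = √(∑_j max{m - C‖x_j - x₀‖, 0}² / σ_j²)`. -/
def FixedPointEq {d n : ℕ} (C : NNReal) (x₀ : EuclideanSpace ℝ (Fin d))
    (x : Fin n → EuclideanSpace ℝ (Fin d)) (σ : Fin n → ℝ) (m : ℝ) : Prop :=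
  stdCdf (-√(∑ j, excess C x₀ x m j ^ 2 / σ j ^ 2)) /
      stdPdf (-√(∑ j, excess C x₀ x m j ^ 2 / σ j ^ 2)) =
    m * ((∑ j, excess C x₀ x m j / σ j ^ 2) / √(∑ j, excess C x₀ x m j ^ 2 / σ j ^ 2))

/-- The piecewise linear rule with cut-off `ρ`, applied to the signal `Y₁`. -/
def linearRule {n : ℕ} [NeZero n] (ρ : ℝ) (y : EuclideanSpace ℝ (Fin n)) : ℝ :=
  if y 0 < -ρ then 0 else if y 0 ≤ ρ then (y 0 + ρ) / (2 * ρ) else 1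

/-- The rule `Φ(Y₁ / σ̃)`, where `σ̃ = √(2 C² ‖x₁ - x₀‖² / π - σ₁²)`. -/
def probitRule {d n : ℕ} [NeZero n] (C : NNReal) (x₀ : EuclideanSpace ℝ (Fin d))
    (x : Fin n → EuclideanSpace ℝ (Fin d)) (σ : Fin n → ℝ) (y : EuclideanSpace ℝ (Fin n)) : ℝ :=
  stdCdf (y 0 / √(2 * (C : ℝ) ^ 2 * ‖x 0 - x₀‖ ^ 2 / Real.pi - σ 0 ^ 2))

end EvidenceAggregation

end

open EvidenceAggregation

/-!
The argument compares the maximal regret of each rule with the Bayes risk under a two-point prior.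

*Lower bounds.* For `m > 0` consider the prior with equal weights on `± cone C x₀ m`, where
`cone C x₀ m = max{m - C‖· - x₀‖, 0}`. Writing the laws of the data as densities against the pure
noise model, the Bayes rule is the likelihood ratio test `1{∑ max{m - k_j, 0} Y_j / σ_j² ≥ 0}`, it
is unique up to null sets, and its risk is `m Φ(-s(m))` (`likelihoodRatio_optimal`). For `m = k₁`
the data carry no information and the risk is `k₁ / 2` for every rule (`half_bias_le_maxRegret`).

*Upper bounds.* For each rule in the statement, `E_θ δ = 1 - F(l)`, where `l` is a weighted average
of the `θ(x_j)` and `F` is a symmetric tail; since `θ` is Lipschitz, `l` differs from `θ(x₀)` by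
at most some `k`. Hence the regret is at most `sup_M M F(M - k)` (`regret_le_of_tail`). All these tails
are log-concave, so `-F / F'` does not increase and a critical point `m` of `M F(M - k)` is its strict
global maximum (`LogConcaveTail.mul_lt`). The critical point equation is the fixed point equation
for `m` in the case of a small bias; in the other cases it says that `m = k = k₁`, and then the
bound is `k₁ F(0) = k₁ / 2`. For the piecewise linear rule `F` is the tail of a normal plus an
independent uniform variable, and the equation for `ρ*` is the critical point equation; for the
probit rule the noise of the rule and that of the signal add up to variance `2 k₁² / π`. The
strictness of the maximum also gives uniqueness of the fixed point
(`bayesRisk_lt_of_fixedPoint`).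

*Threshold rules.* If the bias is large the minimax value is `k₁ / 2`. A linear threshold rule that
attains it must have `c = 0` (uninformative data), no weight on `x_j` for `j ≥ 2` (otherwise
perturbing `θ(x_j)` about zero raises the regret above `k₁ / 2`), and positive weight on `x₁`; but
the regret of `1{Y₁ ≥ 0}` at `M - C‖· - x₀‖` has nonzero derivative in `M` at `M = k₁`.
-/

open Filter Topology Set

namespace EvidenceAggregation

/-! ### The standard normal distribution function -/

theorem stdPdf_eq (t : ℝ) : stdPdf t = (√(2 * Real.pi))⁻¹ * Real.exp (-t ^ 2 / 2) := by
  simp [stdPdf, gaussianPDFReal]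

theorem stdPdf_pos (t : ℝ) : 0 < stdPdf t := gaussianPDFReal_pos _ _ _ one_ne_zero

theorem stdPdf_neg (t : ℝ) : stdPdf (-t) = stdPdf t := by simp [stdPdf_eq]

theorem hasDerivAt_stdPdf (t : ℝ) : HasDerivAt stdPdf (-(t * stdPdf t)) t := by
  have h1 : HasDerivAt (fun t : ℝ => -t ^ 2 / 2) (-t) t := by
    refine ((hasDerivAt_pow 2 t).neg.div_const 2).congr_deriv ?_
    norm_num; ring
  have h2 : stdPdf = fun t => (√(2 * Real.pi))⁻¹ * Real.exp (-t ^ 2 / 2) := funext stdPdf_eq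
  rw [h2]
  exact (h1.exp.const_mul _).congr_deriv (by ring)

theorem continuous_stdPdf : Continuous stdPdf :=
  continuous_iff_continuousAt.2 fun t => (hasDerivAt_stdPdf t).continuousAt

theorem stdPdf_zero : stdPdf 0 = (√(2 * Real.pi))⁻¹ := by simp [stdPdf_eq]

theorem stdPdf_strictAntiOn : StrictAntiOn stdPdf (Ici 0) := by
  intro a ha b hb hab
  simp only [mem_Ici] at ha hb
  rw [stdPdf_eq, stdPdf_eq]
  gcongr

theorem stdPdf_tendsto_atTop : Tendsto stdPdf atTop (𝓝 0) := by
  have h2 : stdPdf = fun t => (√(2 * Real.pi))⁻¹ * Real.exp (-t ^ 2 / 2) := funext stdPdf_eq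
  rw [h2, ← mul_zero (√(2 * Real.pi))⁻¹]
  refine Tendsto.const_mul _ (Real.tendsto_exp_atBot.comp ?_)
  have : Tendsto (fun t : ℝ => t ^ 2 / 2) atTop atTop :=
    (tendsto_pow_atTop two_ne_zero).atTop_div_const two_pos
  refine (tendsto_neg_atTop_atBot.comp this).congr fun t => ?_
  simp only [Function.comp]; ring

theorem stdCdf_eq_integral (t : ℝ) : stdCdf t = ∫ u in Iic t, stdPdf u := by
  rw [stdCdf, cdf_eq_real, measureReal_def, gaussianReal_apply_eq_integral _ one_ne_zero,
    ENNReal.toReal_ofReal]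
  · rfl
  · exact integral_nonneg fun u => gaussianPDFReal_nonneg _ _ _

theorem hasDerivAt_stdCdf (t : ℝ) : HasDerivAt stdCdf (stdPdf t) t := by
  have hint : Integrable stdPdf := integrable_gaussianPDFReal 0 1
  have h : stdCdf = fun t => (∫ u in (0 : ℝ)..t, stdPdf u) + stdCdf 0 := by
    funext t
    rw [stdCdf_eq_integral, stdCdf_eq_integral,
      ← intervalIntegral.integral_Iic_sub_Iic hint.integrableOn hint.integrableOn]
    ring
  rw [h]
  exact (intervalIntegral.integral_hasDerivAt_right (hint.intervalIntegrable)
    (continuous_stdPdf.stronglyMeasurableAtFilter _ _) continuous_stdPdf.continuousAt).add_const _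

theorem continuous_stdCdf : Continuous stdCdf :=
  continuous_iff_continuousAt.2 fun t => (hasDerivAt_stdCdf t).continuousAt

theorem stdCdf_strictMono : StrictMono stdCdf :=
  strictMono_of_hasDerivAt_pos hasDerivAt_stdCdf stdPdf_pos

theorem stdCdf_pos (t : ℝ) : 0 < stdCdf t :=
  (cdf_nonneg _ (t - 1)).trans_lt (stdCdf_strictMono (by linarith))

theorem stdCdf_le_one (t : ℝ) : stdCdf t ≤ 1 := cdf_le_one _ _

theorem stdCdf_tendsto_atBot : Tendsto stdCdf atBot (𝓝 0) := tendsto_cdf_atBot _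

theorem stdCdf_neg (t : ℝ) : stdCdf (-t) = 1 - stdCdf t := by
  have hd : ∀ t, HasDerivAt (fun t => stdCdf (-t) + stdCdf t) 0 t := fun t => by
    refine (((hasDerivAt_stdCdf (-t)).comp t (hasDerivAt_neg t)).add
      (hasDerivAt_stdCdf t)).congr_deriv ?_
    rw [stdPdf_neg]; ring
  have hc : ∀ s, stdCdf (-s) + stdCdf s = stdCdf (-t) + stdCdf t := fun s =>
    is_const_of_deriv_eq_zero (fun t => (hd t).differentiableAt) (fun t => (hd t).deriv) s t
  have hl : Tendsto (fun s => stdCdf (-s) + stdCdf s) atTop (𝓝 (0 + 1)) :=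
    (stdCdf_tendsto_atBot.comp tendsto_neg_atTop_atBot).add (tendsto_cdf_atTop _)
  have := tendsto_nhds_unique ((tendsto_congr hc).1 hl) tendsto_const_nhds
  linarith

theorem stdCdf_zero : stdCdf 0 = 1 / 2 := by
  have := stdCdf_neg 0
  rw [neg_zero] at this; linarith

/-! ### Tails of log-concave laws -/

/-- `F` is a positive function with derivative `-f < 0`, such that the inverse hazard rate `F / f`
does not increase. For the survival function `F` and the density `f` of a probability law, the last
condition says that `F` is log-concave. -/
structure LogConcaveTail (F f : ℝ → ℝ) : Prop where
  pos : ∀ t, 0 < F t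
  dens_pos : ∀ t, 0 < f t
  hasDerivAt : ∀ t, HasDerivAt F (-f t) t
  ratio_antitone : Antitone fun t => F t / f t

/-- A density `f` with nondecreasing score `-f' / f` has a log-concave tail. -/
theorem LogConcaveTail.of_score {F f e : ℝ → ℝ} (hF : ∀ t, 0 < F t) (hf : ∀ t, 0 < f t)
    (hFd : ∀ t, HasDerivAt F (-f t) t) (hfd : ∀ t, HasDerivAt f (-(e t * f t)) t)
    (he : Monotone e) (hF0 : Tendsto F atTop (𝓝 0)) (hf0 : Tendsto f atTop (𝓝 0)) :
    LogConcaveTail F f where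
  pos := hF
  dens_pos := hf
  hasDerivAt := hFd
  ratio_antitone := by
    intro s t hst
    change F t / f t ≤ F s / f s
    rw [div_le_div_iff₀ (hf t) (hf s)]
    rcases hst.eq_or_lt with rfl | hlt
    · rfl
    -- `K` vanishes at `s` and at infinity; its derivative changes sign at most once, from
    -- positive to negative, so `K` cannot be negative in between.
    set K : ℝ → ℝ := fun u => F s * f u - f s * F u with hK
    have hKd : ∀ u, HasDerivAt K (f u * (f s - F s * e u)) u := fun u =>
      (((hfd u).const_mul (F s)).sub ((hFd u).const_mul (f s))).congr_deriv (by ring)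
    have hKs : K s = 0 := by simp only [hK]; ring
    suffices h : 0 ≤ K t by simp only [hK] at h; linarith
    by_contra! hneg
    obtain ⟨ξ, hξ, hξe⟩ := exists_hasDerivAt_eq_slope K (fun u => f u * (f s - F s * e u)) hlt
      (fun u _ => (hKd u).continuousAt.continuousWithinAt) (fun u _ => hKd u)
    have h1 : f s < F s * e ξ := by
      have h2 : f ξ * (f s - F s * e ξ) < 0 := by
        rw [hξe, hKs, sub_zero]
        exact div_neg_of_neg_of_pos hneg (sub_pos.2 hlt)
      nlinarith [hf ξ]
    have hanti : AntitoneOn K (Ici ξ) := by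
      refine antitoneOn_of_deriv_nonpos (convex_Ici ξ)
        (fun u _ => (hKd u).continuousAt.continuousWithinAt)
        (fun u _ => (hKd u).differentiableAt.differentiableWithinAt) fun u hu => ?_
      rw [interior_Ici, mem_Ioi] at hu
      rw [(hKd u).deriv]
      have h3 : F s * e ξ ≤ F s * e u := mul_le_mul_of_nonneg_left (he hu.le) (hF s).le
      exact mul_nonpos_of_nonneg_of_nonpos (hf u).le (by linarith)
    have hlim : Tendsto K atTop (𝓝 (F s * 0 - f s * 0)) :=
      (hf0.const_mul _).sub (hF0.const_mul _)
    have hle : F s * 0 - f s * 0 ≤ K t := le_of_tendsto hlim <|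
      (eventually_ge_atTop t).mono fun u hu => hanti hξ.2.le (hξ.2.le.trans hu) hu
    linarith

theorem LogConcaveTail.comp_div {F f : ℝ → ℝ} (h : LogConcaveTail F f) {τ : ℝ} (hτ : 0 < τ) :
    LogConcaveTail (fun t => F (t / τ)) (fun t => f (t / τ) / τ) where
  pos t := h.pos _
  dens_pos t := div_pos (h.dens_pos _) hτ
  hasDerivAt t :=
    ((h.hasDerivAt (t / τ)).comp t ((hasDerivAt_id t).div_const τ)).congr_deriv (by simp; ring)
  ratio_antitone := by
    intro s t hst
    have := mul_le_mul_of_nonneg_right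
      (h.ratio_antitone (div_le_div_of_nonneg_right hst hτ.le)) hτ.le
    simp only [div_div_eq_mul_div] at this ⊢
    simpa only [div_mul_eq_mul_div] using this

theorem LogConcaveTail.antitone {F f : ℝ → ℝ} (h : LogConcaveTail F f) : Antitone F :=
  antitone_of_hasDerivAt_nonpos h.hasDerivAt fun t => (neg_neg_of_pos (h.dens_pos t)).le

theorem LogConcaveTail.hasDerivAt_mul {F f : ℝ → ℝ} (h : LogConcaveTail F f) (k M : ℝ) :
    HasDerivAt (fun M => M * F (M - k)) (F (M - k) - M * f (M - k)) M :=
  ((hasDerivAt_id M).mul ((h.hasDerivAt (M - k)).comp M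
    ((hasDerivAt_id M).sub_const k))).congr_deriv (by simp; ring)

/-- For a log-concave tail `F`, a critical point of `M ↦ M F(M - k)` is its strict global
maximum. -/
theorem LogConcaveTail.mul_lt {F f : ℝ → ℝ} (h : LogConcaveTail F f) {k m M : ℝ}
    (hm : F (m - k) = m * f (m - k)) (hM : M ≠ m) : M * F (M - k) < m * F (m - k) := by
  set R : ℝ → ℝ := fun M => M * F (M - k) with hR
  have hRd : ∀ M, HasDerivAt R (F (M - k) - M * f (M - k)) M :=
    h.hasDerivAt_mul k
  have hm' : F (m - k) / f (m - k) = m := by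
    rw [hm, mul_div_assoc, div_self (h.dens_pos _).ne', mul_one]
  have hcont : ∀ s, ContinuousOn R s := fun s M _ => (hRd M).continuousAt.continuousWithinAt
  rcases hM.lt_or_gt with hlt | hgt
  · refine strictMonoOn_of_deriv_pos (convex_Iic m) (hcont _) (fun u hu => ?_) hlt.le
      (mem_Iic.2 le_rfl) hlt
    rw [interior_Iic, mem_Iio] at hu
    have := h.ratio_antitone (sub_le_sub_right hu.le k)
    simp only [hm'] at this
    rw [le_div_iff₀ (h.dens_pos _)] at this
    rw [(hRd u).deriv]
    nlinarith [h.dens_pos (u - k)]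
  · refine strictAntiOn_of_deriv_neg (convex_Ici m) (hcont _) (fun u hu => ?_)
      (mem_Ici.2 le_rfl) hgt.le hgt
    rw [interior_Ici, mem_Ioi] at hu
    have := h.ratio_antitone (sub_le_sub_right hu.le k)
    simp only [hm'] at this
    rw [div_le_iff₀ (h.dens_pos _)] at this
    rw [(hRd u).deriv]
    nlinarith [h.dens_pos (u - k)]

theorem LogConcaveTail.mul_le {F f : ℝ → ℝ} (h : LogConcaveTail F f) {k m : ℝ}
    (hm : F (m - k) = m * f (m - k)) (M : ℝ) : M * F (M - k) ≤ m * F (m - k) := by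
  rcases eq_or_ne M m with rfl | hM
  · rfl
  · exact (h.mul_lt hm hM).le

theorem tendsto_stdCdf_neg_atTop : Tendsto (fun t => stdCdf (-t)) atTop (𝓝 0) :=
  stdCdf_tendsto_atBot.comp tendsto_neg_atTop_atBot

theorem logConcaveTail_normal : LogConcaveTail (fun t => stdCdf (-t)) stdPdf :=
  LogConcaveTail.of_score (e := id) (fun _ => stdCdf_pos _) stdPdf_pos
    (fun t => ((hasDerivAt_stdCdf (-t)).comp t (hasDerivAt_neg t)).congr_deriv
      (by rw [stdPdf_neg]; ring))
    hasDerivAt_stdPdf monotone_id tendsto_stdCdf_neg_atTop stdPdf_tendsto_atTop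

/-! ### The tail of a normal law smoothed by a uniform one -/

/-- The antiderivative `x Φ(x) + φ(x)` of the standard normal distribution function. -/
noncomputable def stdCdfPrimitive (x : ℝ) : ℝ := x * stdCdf x + stdPdf x

theorem hasDerivAt_stdCdfPrimitive (x : ℝ) : HasDerivAt stdCdfPrimitive (stdCdf x) x :=
  (((hasDerivAt_id x).mul (hasDerivAt_stdCdf x)).add (hasDerivAt_stdPdf x)).congr_deriv
    (by simp)

/-- The survival function of `Z + U`, for independent `Z` standard normal and `U` uniform on
`[-b, b]`, in closed form; see `integral_stdCdf_sub`. -/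
noncomputable def smoothTail (b t : ℝ) : ℝ :=
  (stdCdfPrimitive (b - t) - stdCdfPrimitive (-b - t)) / (2 * b)

/-- The density of `Z + U`, for independent `Z` standard normal and `U` uniform on `[-b, b]`. -/
noncomputable def smoothDens (b t : ℝ) : ℝ := (stdCdf (b - t) - stdCdf (-b - t)) / (2 * b)

theorem integral_stdCdf_sub (b t : ℝ) :
    ∫ u in (-b)..b, stdCdf (u - t) = stdCdfPrimitive (b - t) - stdCdfPrimitive (-b - t) := by
  rw [intervalIntegral.integral_comp_sub_right (fun v => stdCdf v),
    intervalIntegral.integral_eq_sub_of_hasDerivAt (fun x _ => hasDerivAt_stdCdfPrimitive x)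
      (continuous_stdCdf.intervalIntegrable _ _)]

theorem smoothTail_neg {b : ℝ} (hb : 0 < b) (t : ℝ) :
    smoothTail b (-t) = 1 - smoothTail b t := by
  have h : ∀ x, stdCdfPrimitive (-x) = stdCdfPrimitive x - x := fun x => by
    simp only [stdCdfPrimitive, stdCdf_neg, stdPdf_neg]; ring
  have h1 := h (t - b)
  have h2 := h (b + t)
  rw [smoothTail, smoothTail, eq_sub_iff_add_eq, ← add_div, div_eq_one_iff_eq (by positivity)]
  rw [show b - t = -(t - b) by ring, show -b - t = -(b + t) by ring,
    show b - -t = b + t by ring, show -b - -t = t - b by ring]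
  linarith

theorem hasDerivAt_comp_sub {f : ℝ → ℝ} {f' c t : ℝ} (h : HasDerivAt f f' (c - t)) :
    HasDerivAt (fun t => f (c - t)) (-f') t :=
  (h.comp t ((hasDerivAt_id t).const_sub c)).congr_deriv (by simp)

/-- The score of the uniformly smoothed normal density does not decrease: with
`α = -b - t < β = b - t`, the score is minus the mean of the normal law conditioned on
`[α, β]`, and this mean lies in `[α, β]`. -/
theorem monotone_smooth_score {b : ℝ} (hb : 0 < b) :
    Monotone fun t => (stdPdf (b - t) - stdPdf (-b - t)) /
      (stdCdf (b - t) - stdCdf (-b - t)) := by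
  have hD : ∀ t, 0 < stdCdf (b - t) - stdCdf (-b - t) := fun t =>
    sub_pos.2 (stdCdf_strictMono (by linarith))
  have hderiv := fun t => ((hasDerivAt_comp_sub (hasDerivAt_stdPdf (b - t))).sub
    (hasDerivAt_comp_sub (hasDerivAt_stdPdf (-b - t)))).div
    ((hasDerivAt_comp_sub (hasDerivAt_stdCdf (b - t))).sub
    (hasDerivAt_comp_sub (hasDerivAt_stdCdf (-b - t)))) (hD t).ne'
  refine monotone_of_hasDerivAt_nonneg hderiv fun t => div_nonneg ?_ (sq_nonneg _)
  simp only [Pi.sub_apply]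
  obtain ⟨ξ, hξ, hξe⟩ := exists_ratio_hasDerivAt_eq_ratio_slope stdPdf
    (fun u => -(u * stdPdf u)) (a := -b - t) (b := b - t) (by linarith)
    continuous_stdPdf.continuousOn (fun u _ => hasDerivAt_stdPdf u) stdCdf stdPdf
    continuous_stdCdf.continuousOn (fun u _ => hasDerivAt_stdCdf u)
  have hN : stdPdf (b - t) - stdPdf (-b - t) = -(ξ * (stdCdf (b - t) - stdCdf (-b - t))) := by
    have := stdPdf_pos ξ
    have h2 : stdPdf ξ * (stdPdf (b - t) - stdPdf (-b - t)
        + ξ * (stdCdf (b - t) - stdCdf (-b - t))) = 0 := by linarith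
    rcases mul_eq_zero.1 h2 with h | h <;> linarith
  rw [hN]
  have hD' := hD t
  set D := stdCdf (b - t) - stdCdf (-b - t)
  have h1 : 0 ≤ D * ((b - t - ξ) * stdPdf (b - t)) :=
    mul_nonneg hD'.le (mul_nonneg (by linarith [hξ.2]) (stdPdf_pos _).le)
  have h2 : 0 ≤ D * ((ξ - (-b - t)) * stdPdf (-b - t)) :=
    mul_nonneg hD'.le (mul_nonneg (by linarith [hξ.1]) (stdPdf_pos _).le)
  linarith

theorem smoothDens_pos {b : ℝ} (hb : 0 < b) (t : ℝ) : 0 < smoothDens b t :=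
  div_pos (sub_pos.2 (stdCdf_strictMono (by linarith))) (by positivity)

theorem logConcaveTail_smooth {b : ℝ} (hb : 0 < b) :
    LogConcaveTail (smoothTail b) (smoothDens b) := by
  have hmv : ∀ t, ∃ ξ ∈ Ioo (-b - t) (b - t), smoothTail b t = stdCdf ξ := fun t => by
    obtain ⟨ξ, hξ, hξe⟩ := exists_hasDerivAt_eq_slope stdCdfPrimitive stdCdf
      (a := -b - t) (b := b - t) (by linarith)
      (fun u _ => (hasDerivAt_stdCdfPrimitive u).continuousAt.continuousWithinAt)
      (fun u _ => hasDerivAt_stdCdfPrimitive u)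
    exact ⟨ξ, hξ, by rw [hξe, smoothTail]; ring_nf⟩
  have hlim : ∀ c : ℝ, Tendsto (fun t => stdCdf (c - t)) atTop (𝓝 0) := fun c =>
    stdCdf_tendsto_atBot.comp
      (tendsto_atBot_add_const_left _ c tendsto_neg_atTop_atBot)
  refine LogConcaveTail.of_score (fun t => ?_) (smoothDens_pos hb) (fun t => ?_) (fun t => ?_)
    (monotone_smooth_score hb) ?_ ?_
  · obtain ⟨ξ, -, h⟩ := hmv t
    exact h ▸ stdCdf_pos ξ
  · exact (((hasDerivAt_comp_sub (hasDerivAt_stdCdfPrimitive (b - t))).sub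
      (hasDerivAt_comp_sub (hasDerivAt_stdCdfPrimitive (-b - t)))).div_const (2 * b)).congr_deriv
      (by rw [smoothDens]; ring)
  · refine (((hasDerivAt_comp_sub (hasDerivAt_stdCdf (b - t))).sub
      (hasDerivAt_comp_sub (hasDerivAt_stdCdf (-b - t)))).div_const (2 * b)).congr_deriv ?_
    have hD : stdCdf (b - t) - stdCdf (-b - t) ≠ 0 :=
      (sub_pos.2 (stdCdf_strictMono (by linarith))).ne'
    rw [smoothDens]
    field_simp
    ring
  · refine squeeze_zero (fun t => ?_) (fun t => ?_) (hlim b)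
    · obtain ⟨ξ, -, h⟩ := hmv t
      exact h ▸ (stdCdf_pos ξ).le
    · obtain ⟨ξ, hξ, h⟩ := hmv t
      exact h ▸ stdCdf_strictMono.monotone hξ.2.le
  · have := ((hlim b).sub (hlim (-b))).div_const (2 * b)
    rw [sub_zero, zero_div] at this
    exact this

/-! ### The cut-off of the piecewise linear rule -/

theorem sqrt_two_pi_div_two : √(2 * Real.pi) / 2 = √(Real.pi / 2) := by
  rw [show 2 * Real.pi = Real.pi / 2 * 2 ^ 2 by ring, Real.sqrt_mul (by positivity),
    Real.sqrt_sq (by norm_num)]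
  ring

theorem stdPdf_zero_mul_sqrt : stdPdf 0 * √(Real.pi / 2) = 1 / 2 := by
  have : √(2 * Real.pi) ≠ 0 := (Real.sqrt_pos.2 (by positivity)).ne'
  rw [← sqrt_two_pi_div_two, stdPdf_zero]
  field_simp

theorem existsUnique_linear_cutoff {k s : ℝ} (hs : 0 < s) (hk : √(Real.pi / 2) * s < k) :
    ∃ ρ ∈ Ioo 0 k, ρ = k * (1 - 2 * stdCdf (-ρ / s)) ∧
      ∀ ρ' ∈ Ioo 0 k, ρ' = k * (1 - 2 * stdCdf (-ρ' / s)) → ρ' = ρ := by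
  have hk0 : 0 < k := lt_of_le_of_lt (by positivity) hk
  -- `ψ` is strictly concave on `[0, ∞)`, vanishes at `0`, has positive slope there and is
  -- negative at `k`.
  set ψ : ℝ → ℝ := fun ρ => k * (1 - 2 * stdCdf (-ρ / s)) - ρ with hψ
  have hd : ∀ ρ, HasDerivAt ψ (2 * k / s * stdPdf (ρ / s) - 1) ρ := fun ρ => by
    have h1 : HasDerivAt (fun ρ => -ρ / s) (-1 / s) ρ := (hasDerivAt_neg ρ).div_const s
    refine ((((((hasDerivAt_stdCdf (-ρ / s)).comp ρ h1).const_mul 2).const_sub 1).const_mul k).sub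
      (hasDerivAt_id ρ)).congr_deriv ?_
    rw [neg_div, stdPdf_neg]; ring
  have hcont : Continuous ψ := continuous_iff_continuousAt.2 fun ρ => (hd ρ).continuousAt
  have h0 : ψ 0 = 0 := by simp only [hψ, neg_zero, zero_div, stdCdf_zero]; ring
  have hconc : StrictConcaveOn ℝ (Ici 0) ψ := by
    refine StrictAntiOn.strictConcaveOn_of_deriv (convex_Ici 0) hcont.continuousOn ?_
    rw [interior_Ici]
    intro a ha b hb hab
    rw [(hd a).deriv, (hd b).deriv]
    have := stdPdf_strictAntiOn (mem_Ici.2 (div_nonneg (mem_Ioi.1 ha).le hs.le))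
      (mem_Ici.2 (div_nonneg (mem_Ioi.1 hb).le hs.le)) (div_lt_div_of_pos_right hab hs)
    have := mul_lt_mul_of_pos_left this (show 0 < 2 * k / s by positivity)
    linarith
  have hslope : 0 < 2 * k / s * stdPdf (0 / s) - 1 := by
    have h1 := stdPdf_zero_mul_sqrt
    have h2 := mul_lt_mul_of_pos_left hk (stdPdf_pos 0)
    rw [zero_div, sub_pos, div_mul_eq_mul_div, one_lt_div hs]
    nlinarith
  obtain ⟨ε, hε0, hεk, hε⟩ : ∃ ε, 0 < ε ∧ ε < k ∧ 0 < ψ ε := by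
    have h1 := (hasDerivAt_iff_tendsto_slope.1 (hd 0)).eventually (lt_mem_nhds hslope)
    have h2 : ∀ᶠ ε in 𝓝[>] (0 : ℝ), 0 < slope ψ 0 ε :=
      h1.filter_mono (nhdsWithin_mono 0 fun a ha => (mem_Ioi.1 ha).ne')
    obtain ⟨ε, hε, hεI⟩ := (h2.and (Ioo_mem_nhdsGT hk0)).exists
    refine ⟨ε, hεI.1, hεI.2, ?_⟩
    rw [slope_def_field, h0, sub_zero, sub_zero] at hε
    exact (div_pos_iff_of_pos_right hεI.1).1 hε
  have hψk : ψ k < 0 := by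
    simp only [hψ]
    nlinarith [mul_pos hk0 (stdCdf_pos (-k / s))]
  obtain ⟨ρ, hρ, hρ0⟩ := intermediate_value_Icc' hεk.le hcont.continuousOn
    (mem_Icc.2 ⟨hψk.le, hε.le⟩)
  have hρk : ρ ≠ k := fun h => by rw [h] at hρ0; exact hψk.ne hρ0
  refine ⟨ρ, ⟨hε0.trans_le hρ.1, lt_of_le_of_ne hρ.2 hρk⟩, ?_, ?_⟩
  · simp only [hψ] at hρ0; linarith
  have key : ∀ a b, 0 < a → a < b → ψ a = 0 → ψ b = 0 → False := fun a b ha hab h1 h2 => by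
    have : (1 - a / b) • ψ 0 + (a / b) • ψ b < ψ ((1 - a / b) • 0 + (a / b) • b) :=
      hconc.2 (mem_Ici.2 le_rfl) (mem_Ici.2 (ha.trans hab).le) (ha.trans hab).ne
      (by rw [sub_pos, div_lt_one (ha.trans hab)]; exact hab)
      (div_pos ha (ha.trans hab)) (by ring)
    rw [h0, h2, smul_zero, smul_zero, add_zero, zero_add, smul_eq_mul,
      div_mul_cancel₀ _ (ha.trans hab).ne', h1] at this
    exact lt_irrefl _ this
  intro ρ' hρ' h'
  have hρ'0 : ψ ρ' = 0 := by simp only [hψ]; linarith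
  rcases lt_trichotomy ρ' ρ with h | h | h
  · exact (key _ _ hρ'.1 h hρ'0 hρ0).elim
  · exact h
  · exact (key _ _ (hε0.trans_le hρ.1) h hρ0 hρ'0).elim

/-! ### The fixed point equation -/

section FixedPoint

variable {d n : ℕ} {C : NNReal} {x₀ : EuclideanSpace ℝ (Fin d)}
  {x : Fin n → EuclideanSpace ℝ (Fin d)} {σ : Fin n → ℝ}

/-- The signal-to-noise ratio `s = √(∑_j max{m - k_j, 0}² / σ_j²)` of the fixed point equation. -/
noncomputable def snr (C : NNReal) (x₀ : EuclideanSpace ℝ (Fin d))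
    (x : Fin n → EuclideanSpace ℝ (Fin d)) (σ : Fin n → ℝ) (m : ℝ) : ℝ :=
  √(∑ j, excess C x₀ x m j ^ 2 / σ j ^ 2)

theorem excess_nonneg (m : ℝ) (j : Fin n) : 0 ≤ excess C x₀ x m j := le_max_right _ _

theorem sub_le_excess (m : ℝ) (j : Fin n) : m - C * ‖x j - x₀‖ ≤ excess C x₀ x m j :=
  le_max_left _ _

theorem excess_of_le {m : ℝ} {j : Fin n} (h : C * ‖x j - x₀‖ ≤ m) :
    excess C x₀ x m j = m - C * ‖x j - x₀‖ := max_eq_left (sub_nonneg.2 h)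

theorem excess_of_ge {m : ℝ} {j : Fin n} (h : m ≤ C * ‖x j - x₀‖) :
    excess C x₀ x m j = 0 := max_eq_right (sub_nonpos.2 h)

theorem excess_mul_sub (m : ℝ) (j : Fin n) :
    excess C x₀ x m j * (m - C * ‖x j - x₀‖) = excess C x₀ x m j ^ 2 := by
  rcases le_total (C * ‖x j - x₀‖) m with h | h
  · rw [excess_of_le h, sq]
  · rw [excess_of_ge h]; ring

theorem snr_sq (m : ℝ) : snr C x₀ x σ m ^ 2 = ∑ j, excess C x₀ x m j ^ 2 / σ j ^ 2 :=
  Real.sq_sqrt (Finset.sum_nonneg fun _ _ => by positivity)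

theorem sum_excess_mul_sub (m : ℝ) :
    ∑ j, excess C x₀ x m j / σ j ^ 2 * (m - C * ‖x j - x₀‖) = snr C x₀ x σ m ^ 2 := by
  rw [snr_sq]
  refine Finset.sum_congr rfl fun j _ => ?_
  rw [div_mul_eq_mul_div, excess_mul_sub]

theorem continuous_excess (j : Fin n) : Continuous fun m => excess C x₀ x m j := by
  unfold excess; fun_prop

theorem continuous_snr : Continuous fun m => snr C x₀ x σ m := by
  unfold snr
  have := fun j => continuous_excess (C := C) (x₀ := x₀) (x := x) j
  fun_prop

variable [NeZero n]

theorem div_le_snr (hσ : ∀ i, 0 < σ i) (m : ℝ) :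
    (m - C * ‖x 0 - x₀‖) / σ 0 ≤ snr C x₀ x σ m := by
  refine (div_le_div_of_nonneg_right (sub_le_excess m 0) (hσ 0).le).trans ?_
  refine Real.le_sqrt_of_sq_le ?_
  rw [div_pow]
  exact Finset.single_le_sum (f := fun j => excess C x₀ x m j ^ 2 / σ j ^ 2)
    (fun _ _ => by positivity) (Finset.mem_univ 0)

theorem snr_pos (hσ : ∀ i, 0 < σ i) {m : ℝ} (hm : C * ‖x 0 - x₀‖ < m) :
    0 < snr C x₀ x σ m :=
  (div_pos (sub_pos.2 hm) (hσ 0)).trans_le (div_le_snr hσ m)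

theorem sum_excess_pos (hσ : ∀ i, 0 < σ i) {m : ℝ} (hm : C * ‖x 0 - x₀‖ < m) :
    0 < ∑ j, excess C x₀ x m j / σ j ^ 2 := by
  have h0 : 0 < excess C x₀ x m 0 / σ 0 ^ 2 :=
    div_pos ((sub_pos.2 hm).trans_le (sub_le_excess m 0)) (pow_pos (hσ 0) 2)
  exact h0.trans_le (Finset.single_le_sum (f := fun j => excess C x₀ x m j / σ j ^ 2)
    (fun j _ => div_nonneg (excess_nonneg m j) (sq_nonneg _)) (Finset.mem_univ 0))

theorem fixedPointEq_iff (hσ : ∀ i, 0 < σ i) {m : ℝ} (hm : C * ‖x 0 - x₀‖ < m) :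
    FixedPointEq C x₀ x σ m ↔
      stdCdf (-snr C x₀ x σ m) * snr C x₀ x σ m =
        m * (∑ j, excess C x₀ x m j / σ j ^ 2) * stdPdf (snr C x₀ x σ m) := by
  have hs := (snr_pos (x₀ := x₀) (x := x) hσ hm).ne'
  rw [FixedPointEq, ← snr, stdPdf_neg, ← mul_div_assoc, div_eq_div_iff (stdPdf_pos _).ne' hs]

/-- Intermediate value theorem: just above `C ‖x₁ - x₀‖` the left side of the fixed point equation
is the larger one by `hk`, and far above it the right side is. -/
theorem exists_fixedPoint (hσ : ∀ i, 0 < σ i)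
    (hx : ∀ i, i ≠ 0 → ‖x 0 - x₀‖ < ‖x i - x₀‖)
    (hk : C * ‖x 0 - x₀‖ < √(Real.pi / 2) * σ 0) :
    ∃ m, C * ‖x 0 - x₀‖ < m ∧ FixedPointEq C x₀ x σ m := by
  set k := C * ‖x 0 - x₀‖ with hkdef
  have hk0 : 0 ≤ k := by positivity
  have hσ0 := hσ 0
  set g : ℝ → ℝ := fun m => stdCdf (-snr C x₀ x σ m) * snr C x₀ x σ m -
    m * (∑ j, excess C x₀ x m j / σ j ^ 2) * stdPdf (snr C x₀ x σ m) with hg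
  have hgc : Continuous g := by
    have h1 := continuous_snr (C := C) (x₀ := x₀) (x := x) (σ := σ)
    have h2 := fun j => continuous_excess (C := C) (x₀ := x₀) (x := x) j
    have h3 := continuous_stdCdf
    have h4 := continuous_stdPdf
    fun_prop
  suffices h : ∃ m, k < m ∧ g m = 0 by
    obtain ⟨m, hm, h0⟩ := h
    exact ⟨m, hm, (fixedPointEq_iff hσ hm).2 (sub_eq_zero.1 h0)⟩
  -- Slightly above `k` only the first weight is positive (all of them are if `C = 0`), and `g` is
  -- positive.
  obtain ⟨m₁, hm₁, hg₁⟩ : ∃ m, k < m ∧ 0 < g m := by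
    have e1 : ∀ᶠ t in 𝓝 (0 : ℝ), 0 < stdCdf (-t) - (k / σ 0 + t) * stdPdf t := by
      have hc1 : Continuous fun t => stdCdf (-t) - (k / σ 0 + t) * stdPdf t := by
        have h3 := continuous_stdCdf
        have h4 := continuous_stdPdf
        fun_prop
      refine hc1.continuousAt.eventually (lt_mem_nhds ?_)
      simp only [neg_zero, add_zero]
      rw [stdCdf_zero, sub_pos, ← stdPdf_zero_mul_sqrt, mul_comm]
      refine mul_lt_mul_of_pos_left ?_ (stdPdf_pos 0)
      rwa [div_lt_iff₀ hσ0]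
    have e2 : ∀ᶠ t in 𝓝[>] (0 : ℝ), ∃ m, k < m ∧ snr C x₀ x σ m = t ∧
        m * (∑ j, excess C x₀ x m j / σ j ^ 2) = (k / σ 0 + t) * t := by
      rcases eq_or_ne C 0 with hC | hC
      · refine eventually_mem_nhdsWithin.mono fun t (ht : 0 < t) => ?_
        obtain ⟨P, hP, hP2⟩ : ∃ P : ℝ, 0 < P ∧ P ^ 2 = ∑ j, 1 / σ j ^ 2 := by
          have h0 : 0 < ∑ j, 1 / σ j ^ 2 :=
            Finset.sum_pos (fun j _ => by have := hσ j; positivity) ⟨0, Finset.mem_univ 0⟩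
          exact ⟨_, Real.sqrt_pos.2 h0, Real.sq_sqrt h0.le⟩
        have hk' : k = 0 := by simp [hkdef, hC]
        have hm : 0 < t / P := by positivity
        have hexc : ∀ j, excess C x₀ x (t / P) j = t / P := fun j => by
          rw [excess_of_le] <;> simp [hC, hm.le]
        have hsum : t / P * ∑ j, excess C x₀ x (t / P) j / σ j ^ 2 = t ^ 2 := by
          simp_rw [hexc, div_eq_mul_one_div (t / P) (σ _ ^ 2)]
          rw [← Finset.mul_sum, ← hP2]
          field_simp
        refine ⟨t / P, hk' ▸ hm, ?_, by rw [hsum, hk']; ring⟩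
        have hnn : 0 ≤ snr C x₀ x σ (t / P) := Real.sqrt_nonneg _
        rw [← sq_eq_sq₀ hnn ht.le, snr_sq, ← hsum, Finset.mul_sum]
        refine Finset.sum_congr rfl fun j _ => ?_
        rw [hexc]; ring
      · have h2 : ∀ᶠ t in 𝓝 (0 : ℝ), ∀ i, i ≠ 0 → k + σ 0 * t ≤ C * ‖x i - x₀‖ := by
          refine eventually_all.2 fun i => ?_
          by_cases hi : i = 0
          · simp [hi]
          have hlt : k + σ 0 * 0 < C * ‖x i - x₀‖ := by
            rw [mul_zero, add_zero]
            exact mul_lt_mul_of_pos_left (hx i hi) (by positivity)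
          have hc : Continuous fun t => k + σ 0 * t := by fun_prop
          filter_upwards [hc.continuousAt.eventually (gt_mem_nhds hlt)] with t ht _ using ht.le
        filter_upwards [h2.filter_mono nhdsWithin_le_nhds,
          self_mem_nhdsWithin (s := Ioi (0 : ℝ))] with t ht (ht0 : 0 < t)
        have hexc0 : excess C x₀ x (k + σ 0 * t) 0 = σ 0 * t := by
          rw [excess_of_le (by nlinarith), ← hkdef]; ring
        have hexc : ∀ i, i ≠ 0 → excess C x₀ x (k + σ 0 * t) i = 0 := fun i hi =>
          excess_of_ge (ht i hi)
        refine ⟨k + σ 0 * t, by nlinarith, ?_, ?_⟩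
        · rw [snr, Finset.sum_eq_single 0 (fun i _ hi => by rw [hexc i hi]; simp) (by simp), hexc0,
            ← div_pow, Real.sqrt_sq (by positivity)]
          field_simp
        · rw [Finset.sum_eq_single 0 (fun i _ hi => by rw [hexc i hi]; simp) (by simp), hexc0]
          field_simp
    obtain ⟨t, ⟨h1, m, hm, hs, hA⟩, ht0 : 0 < t⟩ :=
      (((e1.filter_mono nhdsWithin_le_nhds).and e2).and
        (self_mem_nhdsWithin (s := Ioi (0 : ℝ)))).exists
    refine ⟨m, hm, ?_⟩
    simp only [hg]
    rw [hs, hA]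
    nlinarith [mul_pos h1 ht0]
  -- At `k + 2 σ₁` the signal-to-noise ratio is at least `2`, and `g` is not positive.
  have hm₂ : k < k + 2 * σ 0 := by linarith
  have hg₂ : g (k + 2 * σ 0) ≤ 0 := by
    set m := k + 2 * σ 0
    set s := snr C x₀ x σ m with hs
    have hs2 : 2 ≤ s := by
      have := div_le_snr (C := C) (x₀ := x₀) (x := x) hσ m
      rwa [← hkdef, show m - k = 2 * σ 0 by simp [m], mul_div_cancel_right₀ _ hσ0.ne'] at this
    have hA : s ^ 2 ≤ m * ∑ j, excess C x₀ x m j / σ j ^ 2 := by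
      rw [hs, ← sum_excess_mul_sub, Finset.mul_sum]
      refine Finset.sum_le_sum fun j _ => ?_
      rw [mul_comm]
      refine mul_le_mul_of_nonneg_right ?_ (div_nonneg (excess_nonneg _ _) (sq_nonneg _))
      have : 0 ≤ C * ‖x j - x₀‖ := by positivity
      linarith
    have hmills : stdCdf (-s) ≤ 2 * stdPdf s := by
      have h1 := logConcaveTail_normal.ratio_antitone (show 0 ≤ s by linarith)
      simp only [neg_zero, stdCdf_zero, ← stdPdf_zero_mul_sqrt] at h1
      rw [mul_div_cancel_left₀ _ (stdPdf_pos 0).ne', div_le_iff₀ (stdPdf_pos s)] at h1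
      have h2 : √(Real.pi / 2) ≤ 2 := by
        rw [Real.sqrt_le_left (by norm_num)]
        linarith [Real.pi_le_four]
      exact h1.trans (mul_le_mul_of_nonneg_right h2 (stdPdf_pos s).le)
    have h3 := mul_le_mul_of_nonneg_right hA (stdPdf_pos s).le
    have h4 := mul_le_mul_of_nonneg_right hmills (show 0 ≤ s by linarith)
    have h5 : 2 * (s * stdPdf s) ≤ s * (s * stdPdf s) :=
      mul_le_mul_of_nonneg_right hs2 (mul_nonneg (by linarith) (stdPdf_pos s).le)
    simp only [hg]
    rw [← hs]
    nlinarith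
  obtain ⟨m, hm, hm0⟩ := intermediate_value_uIcc hgc.continuousOn
    (mem_uIcc.2 (Or.inr ⟨hg₂, hg₁.le⟩) : (0 : ℝ) ∈ uIcc (g m₁) (g (k + 2 * σ 0)))
  exact ⟨m, (lt_min hm₁ hm₂).trans_le hm.1, hm0⟩

end FixedPoint

/-! ### Expectations under one-dimensional normal laws -/

theorem gaussianReal_eq_map {μ σ : ℝ} :
    gaussianReal μ (σ ^ 2).toNNReal = (gaussianReal 0 1).map (fun z => σ * z + μ) := by
  have h : (fun z : ℝ => σ * z + μ) = (· + μ) ∘ (σ * ·) := rfl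
  rw [h, ← Measure.map_map (by fun_prop) (by fun_prop), gaussianReal_map_const_mul,
    gaussianReal_map_add_const]
  congr 1
  · ring
  · rw [mul_one]
    exact Real.toNNReal_of_nonneg (sq_nonneg σ)

theorem nullSingletonClass_gaussianReal_sq {μ σ : ℝ} (hσ : 0 < σ) :
    NullSingletonClass (gaussianReal μ (σ ^ 2).toNNReal) :=
  nullSingletonClass_gaussianReal (Real.toNNReal_pos.2 (pow_pos hσ 2)).ne'

theorem gaussianReal_real_Ici {μ σ : ℝ} (hσ : 0 < σ) (c : ℝ) :
    (gaussianReal μ (σ ^ 2).toNNReal).real (Ici c) = stdCdf ((μ - c) / σ) := by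
  have hna : NullSingletonClass (gaussianReal 0 1) := nullSingletonClass_gaussianReal one_ne_zero
  rw [gaussianReal_eq_map, map_measureReal_apply (by fun_prop) measurableSet_Ici]
  have h : (fun z => σ * z + μ) ⁻¹' Ici c = (Iio (-((μ - c) / σ)))ᶜ := by
    ext z
    simp only [mem_preimage, mem_Ici, mem_compl_iff, mem_Iio, not_lt]
    rw [neg_le_iff_add_nonneg, ← mul_nonneg_iff_of_pos_left hσ, mul_add,
      mul_div_cancel₀ _ hσ.ne']
    constructor <;> intro h <;> linarith
  rw [h, probReal_compl_eq_one_sub measurableSet_Iio, measureReal_congr Iio_ae_eq_Iic,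
    ← cdf_eq_real, ← stdCdf, stdCdf_neg]
  ring

theorem integral_threshold_gaussianReal {μ σ : ℝ} (hσ : 0 < σ) (c : ℝ) :
    ∫ y, (if c ≤ y then (1 : ℝ) else 0) ∂gaussianReal μ (σ ^ 2).toNNReal
      = stdCdf ((μ - c) / σ) := by
  rw [← gaussianReal_real_Ici hσ, ← integral_indicator_one measurableSet_Ici]
  rfl

theorem integral_stdCdf_gaussianReal {μ σ s : ℝ} (hs : 0 < s) :
    ∫ y, stdCdf (y / s) ∂gaussianReal μ (σ ^ 2).toNNReal = stdCdf (μ / √(σ ^ 2 + s ^ 2)) := by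
  have hτ : 0 < √(σ ^ 2 + s ^ 2) := Real.sqrt_pos.2 (by positivity)
  have hconv : gaussianReal μ (σ ^ 2).toNNReal ∗ gaussianReal 0 (s ^ 2).toNNReal =
      gaussianReal μ (√(σ ^ 2 + s ^ 2) ^ 2).toNNReal := by
    rw [gaussianReal_conv_gaussianReal, add_zero, Real.sq_sqrt (by positivity),
      Real.toNNReal_add (sq_nonneg _) (sq_nonneg _)]
  have h := integral_threshold_gaussianReal (μ := μ) hτ 0
  rw [sub_zero] at h
  have hmeas : Measurable fun y : ℝ => if (0 : ℝ) ≤ y then (1 : ℝ) else 0 :=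
    Measurable.ite measurableSet_Ici measurable_const measurable_const
  rw [← h, ← hconv, integral_conv]
  · refine integral_congr_ae (ae_of_all _ fun y => ?_)
    have h2 := integral_threshold_gaussianReal (μ := 0) hs (-y)
    rw [zero_sub, neg_neg] at h2
    simp only [← h2, neg_le_iff_add_nonneg']
  · refine Integrable.of_bound hmeas.aestronglyMeasurable 1 (ae_of_all _ fun y => ?_)
    split_ifs <;> simp

/-- The piecewise linear rule with cut-off `ρ` is the distribution function of the uniform law on
`[-ρ, ρ]`. -/
theorem clip_eq_integral {ρ : ℝ} (hρ : 0 < ρ) (y : ℝ) :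
    (if y < -ρ then 0 else if y ≤ ρ then (y + ρ) / (2 * ρ) else 1) =
      (∫ u in (-ρ)..ρ, if u ≤ y then (1 : ℝ) else 0) / (2 * ρ) := by
  have h1 : (fun u => if u ≤ y then (1 : ℝ) else 0) = (Iic y).indicator 1 := by
    ext u; simp [indicator_apply]
  rw [intervalIntegral.integral_of_le (by linarith), h1, integral_indicator_one measurableSet_Iic,
    measureReal_restrict_apply measurableSet_Iic, inter_comm, Ioc_inter_Iic, Real.volume_real_Ioc]
  split_ifs with h2 h3
  · rw [max_eq_right (by linarith [inf_le_right (a := ρ) (b := y)]), zero_div]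
  · rw [inf_eq_right.2 h3, max_eq_left (by linarith)]; ring
  · rw [inf_eq_left.2 (by linarith), max_eq_left (by linarith), eq_div_iff (by positivity)]; ring

theorem integral_clip_gaussianReal {μ σ ρ : ℝ} (hσ : 0 < σ) (hρ : 0 < ρ) :
    ∫ y, (if y < -ρ then 0 else if y ≤ ρ then (y + ρ) / (2 * ρ) else 1)
        ∂gaussianReal μ (σ ^ 2).toNNReal = 1 - smoothTail (ρ / σ) (μ / σ) := by
  simp_rw [clip_eq_integral hρ]
  rw [integral_div, ← intervalIntegral_integral_swap (f := fun u y => if u ≤ y then (1 : ℝ) else 0)]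
  · simp_rw [integral_threshold_gaussianReal hσ]
    have h1 : ∀ u, stdCdf ((μ - u) / σ) = (fun v => stdCdf (μ / σ - v)) (u / σ) := fun u => by
      simp only [sub_div]
    have h2 : ∀ v, stdCdf (μ / σ - v) = (fun w => stdCdf (w - -(μ / σ))) (-v) := fun v => by
      simp only; ring_nf
    simp_rw [h1]
    rw [intervalIntegral.integral_comp_div (fun v => stdCdf (μ / σ - v)) hσ.ne']
    simp_rw [h2]
    rw [intervalIntegral.integral_comp_neg (fun w => stdCdf (w - -(μ / σ))), neg_div, neg_neg,
      integral_stdCdf_sub, ← smoothTail_neg (div_pos hρ hσ), smoothTail, smul_eq_mul]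
    field_simp
  · have hfin : IsFiniteMeasure (volume.restrict (uIoc (-ρ) ρ)) :=
      isFiniteMeasure_restrict.2 measure_Ioc_lt_top.ne
    refine Integrable.of_bound (Measurable.aestronglyMeasurable ?_) 1 (ae_of_all _ fun p => ?_)
    · exact Measurable.ite (measurableSet_le measurable_fst measurable_snd) measurable_const
        measurable_const
    · simp only [Function.uncurry]
      split_ifs <;> simp

/-! ### The law of the data -/

theorem pi_withDensity {ι : Type*} [Fintype ι] {α : ι → Type*} {mα : ∀ i, MeasurableSpace (α i)}
    (μ : ∀ i, Measure (α i)) [∀ i, IsProbabilityMeasure (μ i)] {f : ∀ i, α i → ENNReal}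
    (hf : ∀ i, Measurable (f i)) [∀ i, SigmaFinite ((μ i).withDensity (f i))] :
    Measure.pi (fun i => (μ i).withDensity (f i)) =
      (Measure.pi μ).withDensity fun y => ∏ i, f i (y i) := by
  refine Measure.pi_eq fun s hs => ?_
  have hind : iIndepFun (fun i (y : ∀ i, α i) => (s i).indicator (f i) (y i)) (Measure.pi μ) :=
    iIndepFun_pi fun i => ((hf i).indicator (hs i)).aemeasurable
  rw [withDensity_apply _ (MeasurableSet.univ_pi hs),
    ← lintegral_indicator (MeasurableSet.univ_pi hs)]
  have hprod : ((univ.pi s).indicator fun y => ∏ i, f i (y i)) =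
      fun y => ∏ i, (s i).indicator (f i) (y i) := by
    ext y
    by_cases hy : y ∈ univ.pi s
    · rw [indicator_of_mem hy]
      exact Finset.prod_congr rfl fun i _ => (indicator_of_mem (hy i (mem_univ i)) _).symm
    · rw [indicator_of_notMem hy]
      obtain ⟨i, hi⟩ : ∃ i, y i ∉ s i := by simpa [Set.mem_pi] using hy
      exact (Finset.prod_eq_zero (Finset.mem_univ i) (indicator_of_notMem hi _)).symm
  rw [hprod, lintegral_prod_eq_prod_lintegral_of_indepFun _ _ hind
    fun i => ((hf i).indicator (hs i)).comp (measurable_pi_apply i)]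
  refine Finset.prod_congr rfl fun i _ => ?_
  rw [(measurePreserving_eval μ i).lintegral_comp ((hf i).indicator (hs i)),
    lintegral_indicator (hs i), withDensity_apply _ (hs i)]

theorem gaussianReal_eq_withDensity {μ σ : ℝ} (hσ : 0 < σ) :
    gaussianReal μ (σ ^ 2).toNNReal = (gaussianReal 0 (σ ^ 2).toNNReal).withDensity
      fun y => ENNReal.ofReal (Real.exp (μ / σ ^ 2 * y - μ ^ 2 / σ ^ 2 / 2)) := by
  have hv : (σ ^ 2).toNNReal ≠ 0 := (Real.toNNReal_pos.2 (pow_pos hσ 2)).ne'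
  rw [gaussianReal_of_var_ne_zero _ hv, gaussianReal_of_var_ne_zero _ hv,
    ← withDensity_mul _ (measurable_gaussianPDF _ _) (by fun_prop)]
  congr 1
  ext y
  simp only [Pi.mul_apply, gaussianPDF]
  rw [← ENNReal.ofReal_mul (gaussianPDFReal_nonneg _ _ _), gaussianPDFReal, gaussianPDFReal,
    mul_assoc (√_)⁻¹, ← Real.exp_add, Real.coe_toNNReal _ (sq_nonneg σ)]
  congr 3
  field_simp
  ring

section DataLaw

variable {d n : ℕ} {x : Fin n → EuclideanSpace ℝ (Fin d)} {σ : Fin n → ℝ}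

instance isProbabilityMeasure_dataLaw (θ : EuclideanSpace ℝ (Fin d) → ℝ) :
    IsProbabilityMeasure (dataLaw x σ θ) := by
  unfold dataLaw; infer_instance

/-- A linear statistic of the data is normal. -/
theorem map_dataLaw (w : Fin n → ℝ) (θ : EuclideanSpace ℝ (Fin d) → ℝ) :
    (dataLaw x σ θ).map (fun y => ∑ i, w i * y i) =
      gaussianReal (∑ i, w i * θ (x i)) (√(∑ i, w i ^ 2 * σ i ^ 2) ^ 2).toNNReal := by
  have hS : (Matrix.diagonal (fun i => σ i ^ 2)).PosSemidef :=
    Matrix.PosSemidef.diagonal (fun i => sq_nonneg (σ i))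
  have hm : Measurable fun y : EuclideanSpace ℝ (Fin n) => ∑ i, w i * y i := by fun_prop
  have : IsProbabilityMeasure ((dataLaw x σ θ).map fun y => ∑ i, w i * y i) :=
    Measure.isProbabilityMeasure_map hm.aemeasurable
  refine Measure.ext_of_charFun (funext fun t => ?_)
  have h1 : charFun ((dataLaw x σ θ).map fun y => ∑ i, w i * y i) t =
      charFun (dataLaw x σ θ) (WithLp.toLp 2 fun i => t * w i) := by
    rw [charFun_apply, charFun_apply, integral_map hm.aemeasurable (by fun_prop)]
    refine integral_congr_ae (ae_of_all _ fun y => ?_)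
    simp only [PiLp.inner_apply, RCLike.inner_apply, conj_trivial, Finset.mul_sum]
    congr 3
    exact Finset.sum_congr rfl fun i _ => by ring
  rw [h1, dataLaw, charFun_multivariateGaussian hS, charFun_gaussianReal]
  have h2 : 0 ≤ ∑ i, w i ^ 2 * σ i ^ 2 := Finset.sum_nonneg fun i _ => by positivity
  rw [Real.sq_sqrt h2, Real.coe_toNNReal _ h2]
  congr 2
  · simp only [PiLp.inner_apply, RCLike.inner_apply, conj_trivial]
    push_cast
    rw [Finset.mul_sum, Finset.sum_mul, Finset.sum_mul]
    exact Finset.sum_congr rfl fun i _ => by ring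
  · simp only [dotProduct, Matrix.mulVec_diagonal]
    push_cast
    rw [Finset.sum_mul]
    congr 1
    exact Finset.sum_congr rfl fun i _ => by ring

theorem integral_threshold_dataLaw {w : Fin n → ℝ} (hw : 0 < √(∑ i, w i ^ 2 * σ i ^ 2)) (c : ℝ)
    (θ : EuclideanSpace ℝ (Fin d) → ℝ) :
    ∫ y, thresholdRule w c y ∂dataLaw x σ θ =
      stdCdf ((∑ i, w i * θ (x i) - c) / √(∑ i, w i ^ 2 * σ i ^ 2)) := by
  rw [← integral_threshold_gaussianReal hw, ← map_dataLaw, integral_map]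
  · simp only [thresholdRule, EReal.coe_le_coe_iff]
  · exact Measurable.aemeasurable (by fun_prop)
  · exact (Measurable.ite measurableSet_Ici measurable_const measurable_const).aestronglyMeasurable

theorem integral_comp_apply_dataLaw (i : Fin n) (θ : EuclideanSpace ℝ (Fin d) → ℝ) {g : ℝ → ℝ}
    (hg : Measurable g) :
    ∫ y, g (y i) ∂dataLaw x σ θ = ∫ y, g y ∂gaussianReal (θ (x i)) (σ i ^ 2).toNNReal := by
  have hS : (Matrix.diagonal (fun i => σ i ^ 2)).PosSemidef :=
    Matrix.PosSemidef.diagonal (fun i => sq_nonneg (σ i))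
  have := measurePreserving_eval_multivariateGaussian
    (μ := WithLp.toLp 2 fun i => θ (x i)) hS (i := i)
  simp only [Matrix.diagonal_apply_eq] at this
  rw [← this.map_eq, integral_map this.measurable.aemeasurable hg.aestronglyMeasurable]
  rfl

/-- The likelihood ratio of the data with respect to the pure noise model. -/
theorem dataLaw_eq_withDensity (hσ : ∀ i, 0 < σ i) (θ : EuclideanSpace ℝ (Fin d) → ℝ) :
    dataLaw x σ θ = (dataLaw x σ 0).withDensity fun y => ENNReal.ofReal
      (Real.exp (∑ i, θ (x i) / σ i ^ 2 * y i - (∑ i, θ (x i) ^ 2 / σ i ^ 2) / 2)) := by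
  rw [dataLaw_eq_pi, dataLaw_eq_pi]
  have hf : ∀ i, Measurable fun y : ℝ => ENNReal.ofReal
      (Real.exp (θ (x i) / σ i ^ 2 * y - θ (x i) ^ 2 / σ i ^ 2 / 2)) := fun i => by fun_prop
  have hg : ∀ i, gaussianReal (θ (x i)) (σ i ^ 2).toNNReal =
      (gaussianReal 0 (σ i ^ 2).toNNReal).withDensity fun y => ENNReal.ofReal
      (Real.exp (θ (x i) / σ i ^ 2 * y - θ (x i) ^ 2 / σ i ^ 2 / 2)) := fun i =>
    gaussianReal_eq_withDensity (hσ i)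
  have hsf : ∀ i, SigmaFinite ((gaussianReal 0 (σ i ^ 2).toNNReal).withDensity fun y =>
      ENNReal.ofReal (Real.exp (θ (x i) / σ i ^ 2 * y - θ (x i) ^ 2 / σ i ^ 2 / 2))) := fun i => by
    rw [← hg i]; infer_instance
  have hprod : ∀ y : Fin n → ℝ, ∏ i, ENNReal.ofReal
      (Real.exp (θ (x i) / σ i ^ 2 * y i - θ (x i) ^ 2 / σ i ^ 2 / 2)) = ENNReal.ofReal
      (Real.exp (∑ i, θ (x i) / σ i ^ 2 * y i - (∑ i, θ (x i) ^ 2 / σ i ^ 2) / 2)) := fun y => by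
    rw [← ENNReal.ofReal_prod_of_nonneg fun i _ => (Real.exp_pos _).le, ← Real.exp_sum,
      Finset.sum_sub_distrib, Finset.sum_div]
  simp only [Pi.zero_apply]
  rw [show (fun i => gaussianReal (θ (x i)) (σ i ^ 2).toNNReal) = fun i => _ from funext hg,
    pi_withDensity _ hf]
  simp_rw [hprod]
  ext s hs
  have hm : Measurable (WithLp.toLp 2 : (Fin n → ℝ) → EuclideanSpace ℝ (Fin n)) := by fun_prop
  rw [Measure.map_apply hm hs, withDensity_apply _ (hm hs), withDensity_apply _ hs,
    setLIntegral_map hs (by fun_prop) hm]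

end DataLaw

/-! ### Minimax regret: upper and lower bounds -/

section Minimax

variable {d n : ℕ} {C : NNReal} {x₀ : EuclideanSpace ℝ (Fin d)}
  {x : Fin n → EuclideanSpace ℝ (Fin d)} {σ : Fin n → ℝ} {δ : EuclideanSpace ℝ (Fin n) → ℝ}

theorem IsDecisionRule.integrable (hδ : IsDecisionRule δ)
    (μ : Measure (EuclideanSpace ℝ (Fin n))) [IsProbabilityMeasure μ] : Integrable δ μ :=
  Integrable.of_bound hδ.1.aestronglyMeasurable 1 (ae_of_all _ fun y => by
    rw [Real.norm_eq_abs, abs_le]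
    exact ⟨by linarith [(hδ.2 y).1], (hδ.2 y).2⟩)

theorem regret_le_maxRegret {θ : EuclideanSpace ℝ (Fin d) → ℝ} (hθ : θ ∈ Params d C) :
    (regret x₀ x σ δ θ : EReal) ≤ maxRegret C x₀ x σ δ :=
  le_iSup₂ (f := fun θ (_ : θ ∈ Params d C) => (regret x₀ x σ δ θ : EReal)) θ hθ

theorem neg_mem_params {θ : EuclideanSpace ℝ (Fin d) → ℝ} (hθ : θ ∈ Params d C) :
    -θ ∈ Params d C := by
  have h : LipschitzWith C θ := hθ
  exact h.neg

theorem isMMR_of_le {v : ℝ} (hδ : IsDecisionRule δ)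
    (hle : ∀ θ ∈ Params d C, regret x₀ x σ δ θ ≤ v)
    (hge : ∀ δ', IsDecisionRule δ' → (v : EReal) ≤ maxRegret C x₀ x σ δ') :
    IsMMR C x₀ x σ δ := by
  refine ⟨hδ, le_antisymm ?_ (iInf₂_le δ hδ)⟩
  exact (iSup₂_le fun θ hθ => EReal.coe_le_coe_iff.2 (hle θ hθ)).trans (le_iInf₂ hge)

theorem IsMMR.regret_le {v : ℝ} {δ' : EuclideanSpace ℝ (Fin n) → ℝ}
    (hδ' : IsMMR C x₀ x σ δ') (hδ : IsDecisionRule δ)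
    (hle : ∀ θ ∈ Params d C, regret x₀ x σ δ θ ≤ v) :
    ∀ θ ∈ Params d C, regret x₀ x σ δ' θ ≤ v := by
  intro θ hθ
  have h1 : maxRegret C x₀ x σ δ' ≤ maxRegret C x₀ x σ δ := hδ'.2 ▸ iInf₂_le δ hδ
  exact EReal.coe_le_coe_iff.1 <| (regret_le_maxRegret hθ).trans <| h1.trans <|
    iSup₂_le fun θ hθ => EReal.coe_le_coe_iff.2 (hle θ hθ)

theorem regret_of_pos {θ : EuclideanSpace ℝ (Fin d) → ℝ} (h : 0 < θ x₀) :
    regret x₀ x σ δ θ = θ x₀ * (1 - ∫ y, δ y ∂dataLaw x σ θ) := by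
  rw [regret, if_pos h.le]

/-- The Bayes risk (times two) under the two-point prior on `θ` and `-θ`. -/
theorem regret_add_regret_neg {θ : EuclideanSpace ℝ (Fin d) → ℝ} (h : 0 < θ x₀) :
    regret x₀ x σ δ θ + regret x₀ x σ δ (-θ) =
      θ x₀ * (1 - (∫ y, δ y ∂dataLaw x σ θ - ∫ y, δ y ∂dataLaw x σ (-θ))) := by
  rw [regret_of_pos h, regret, if_neg (by simpa using h)]
  simp only [Pi.neg_apply]
  ring

theorem le_maxRegret_of_two_point {v : ℝ} {θ : EuclideanSpace ℝ (Fin d) → ℝ}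
    (hθ : θ ∈ Params d C) (h : 2 * v ≤ regret x₀ x σ δ θ + regret x₀ x σ δ (-θ)) :
    (v : EReal) ≤ maxRegret C x₀ x σ δ := by
  rcases le_total v (regret x₀ x σ δ θ) with h1 | h1
  · exact (EReal.coe_le_coe_iff.2 h1).trans (regret_le_maxRegret hθ)
  · have h2 : v ≤ regret x₀ x σ δ (-θ) := by linarith
    exact (EReal.coe_le_coe_iff.2 h2).trans (regret_le_maxRegret (neg_mem_params hθ))

/-- If `δ` treats with probability `1 - F l`, where `F` is a symmetric log-concave tail and `l`
differs from the welfare contrast by at most the bias `k`, then its regret is at most the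
maximum of `M F(M - k)`. -/
theorem regret_le_of_tail {F f : ℝ → ℝ} (hF : LogConcaveTail F f) (hsymm : ∀ t, F (-t) = 1 - F t)
    {k m : ℝ} (hm : F (m - k) = m * f (m - k)) {θ : EuclideanSpace ℝ (Fin d) → ℝ} {l : ℝ}
    (hl : |l - θ x₀| ≤ k) (hδ : ∫ y, δ y ∂dataLaw x σ θ = 1 - F l) :
    regret x₀ x σ δ θ ≤ m * F (m - k) := by
  rw [abs_le] at hl
  rw [regret, hδ]
  split_ifs with h0
  · rw [sub_sub_cancel]
    exact (mul_le_mul_of_nonneg_left (hF.antitone (by linarith)) h0).trans (hF.mul_le hm (θ x₀))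
  · rw [← hsymm, zero_sub, mul_neg, ← neg_mul]
    exact (mul_le_mul_of_nonneg_left (hF.antitone (by linarith)) (by linarith)).trans
      (hF.mul_le hm (-θ x₀))

/-- The cone `max{m - C‖· - x₀‖, 0}`: the member of `Θ` with value `m` at `x₀` and the least
informative data. -/
noncomputable def cone (C : NNReal) (x₀ : EuclideanSpace ℝ (Fin d)) (m : ℝ)
    (y : EuclideanSpace ℝ (Fin d)) : ℝ := max (m - C * ‖y - x₀‖) 0

theorem lipschitzWith_mul_norm_sub (C : NNReal) (z : EuclideanSpace ℝ (Fin d)) :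
    LipschitzWith C fun y => C * ‖y - z‖ := by
  refine LipschitzWith.of_dist_le_mul fun a b => ?_
  rw [Real.dist_eq, ← mul_sub, abs_mul, abs_of_nonneg C.coe_nonneg, dist_eq_norm]
  refine mul_le_mul_of_nonneg_left ?_ C.coe_nonneg
  simpa using abs_norm_sub_norm_le (a - z) (b - z)

theorem lipschitzWith_sub_mul_norm_sub (C : NNReal) (m : ℝ) (z : EuclideanSpace ℝ (Fin d)) :
    LipschitzWith C fun y => m - C * ‖y - z‖ := by
  have := (LipschitzWith.const (α := EuclideanSpace ℝ (Fin d)) m).sub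
    (lipschitzWith_mul_norm_sub C z)
  rwa [zero_add] at this

theorem cone_mem_params (x₀ : EuclideanSpace ℝ (Fin d)) (m : ℝ) : cone C x₀ m ∈ Params d C :=
  (lipschitzWith_sub_mul_norm_sub C m x₀).max_const 0

theorem cone_apply_center {m : ℝ} (hm : 0 ≤ m) : cone C x₀ m x₀ = m := by simp [cone, hm]

theorem cone_apply (m : ℝ) (j : Fin n) : cone C x₀ m (x j) = excess C x₀ x m j := rfl

theorem abs_sub_le_of_mem_params {θ : EuclideanSpace ℝ (Fin d) → ℝ} (hθ : θ ∈ Params d C)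
    (y : EuclideanSpace ℝ (Fin d)) : |θ y - θ x₀| ≤ C * ‖y - x₀‖ := by
  have h : LipschitzWith C θ := hθ
  rw [← Real.dist_eq, ← dist_eq_norm]
  exact h.dist_le_mul y x₀

theorem dataLaw_of_forall_eq_zero {θ : EuclideanSpace ℝ (Fin d) → ℝ} (h : ∀ i, θ (x i) = 0) :
    dataLaw x σ θ = dataLaw x σ 0 := by
  simp only [dataLaw, h, Pi.zero_apply]

theorem isDecisionRule_convex {δ₁ δ₂ : EuclideanSpace ℝ (Fin n) → ℝ} (h₁ : IsDecisionRule δ₁)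
    (h₂ : IsDecisionRule δ₂) {t : ℝ} (ht : t ∈ Icc (0 : ℝ) 1) :
    IsDecisionRule fun y => t * δ₁ y + (1 - t) * δ₂ y :=
  ⟨(h₁.1.const_mul t).add (h₂.1.const_mul (1 - t)), fun y =>
    convex_Icc (0 : ℝ) 1 (h₁.2 y) (h₂.2 y) ht.1 (sub_nonneg.2 ht.2) (by ring)⟩

theorem regret_convex {δ₁ δ₂ : EuclideanSpace ℝ (Fin n) → ℝ} (h₁ : IsDecisionRule δ₁)
    (h₂ : IsDecisionRule δ₂) (t : ℝ) (θ : EuclideanSpace ℝ (Fin d) → ℝ) :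
    regret x₀ x σ (fun y => t * δ₁ y + (1 - t) * δ₂ y) θ =
      t * regret x₀ x σ δ₁ θ + (1 - t) * regret x₀ x σ δ₂ θ := by
  simp only [regret]
  rw [integral_add ((h₁.integrable _).const_mul t) ((h₂.integrable _).const_mul (1 - t)),
    integral_const_mul, integral_const_mul]
  ring

/-! ### The Bayes rule for a symmetric two-point prior -/

theorem thresholdRule_zero (w : Fin n → ℝ) (y : EuclideanSpace ℝ (Fin n)) :
    thresholdRule w 0 y = if 0 ≤ ∑ i, w i * y i then 1 else 0 := by
  simp only [thresholdRule, EReal.coe_nonneg]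

theorem isDecisionRule_thresholdRule (w : Fin n → ℝ) (c : EReal) :
    IsDecisionRule (thresholdRule w c) := by
  constructor
  · unfold thresholdRule
    exact Measurable.ite (measurableSet_le measurable_const (by fun_prop)) measurable_const
      measurable_const
  · intro y
    unfold thresholdRule
    split_ifs <;> simp

theorem integral_sub_integral_neg (hσ : ∀ i, 0 < σ i) (θ : EuclideanSpace ℝ (Fin d) → ℝ)
    (hδ : IsDecisionRule δ) :
    Integrable (fun y => δ y * (Real.exp (-(∑ i, θ (x i) ^ 2 / σ i ^ 2) / 2) *
      (2 * Real.sinh (∑ i, θ (x i) / σ i ^ 2 * y i)))) (dataLaw x σ 0) ∧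
    ∫ y, δ y ∂dataLaw x σ θ - ∫ y, δ y ∂dataLaw x σ (-θ) =
      ∫ y, δ y * (Real.exp (-(∑ i, θ (x i) ^ 2 / σ i ^ 2) / 2) *
        (2 * Real.sinh (∑ i, θ (x i) / σ i ^ 2 * y i))) ∂dataLaw x σ 0 := by
  set g : (EuclideanSpace ℝ (Fin d) → ℝ) → EuclideanSpace ℝ (Fin n) → ℝ := fun θ y =>
    Real.exp (∑ i, θ (x i) / σ i ^ 2 * y i - (∑ i, θ (x i) ^ 2 / σ i ^ 2) / 2) with hg
  have hgm : ∀ θ, Measurable fun y => ENNReal.ofReal (g θ y) := fun θ => by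
    simp only [hg]; fun_prop
  have hfin : ∀ θ, ∀ᵐ y ∂dataLaw x σ 0, ENNReal.ofReal (g θ y) < ⊤ := fun θ =>
    ae_of_all _ fun y => ENNReal.ofReal_lt_top
  have htr : ∀ θ y, (ENNReal.ofReal (g θ y)).toReal = g θ y := fun θ y =>
    ENNReal.toReal_ofReal (Real.exp_pos _).le
  have hE : ∀ θ, ∫ y, δ y ∂dataLaw x σ θ = ∫ y, g θ y * δ y ∂dataLaw x σ 0 := fun θ => by
    rw [dataLaw_eq_withDensity hσ θ,
      integral_withDensity_eq_integral_toReal_smul (hgm θ) (hfin θ)]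
    exact integral_congr_ae (ae_of_all _ fun y => congrArg (· * δ y) (htr θ y))
  have hI : ∀ θ, Integrable (fun y => g θ y * δ y) (dataLaw x σ 0) := fun θ => by
    have h1 := hδ.integrable (dataLaw x σ θ)
    rw [dataLaw_eq_withDensity hσ θ,
      integrable_withDensity_iff_integrable_smul' (hgm θ) (hfin θ)] at h1
    simpa only [htr, smul_eq_mul] using h1
  have hpt : (fun y => δ y * (Real.exp (-(∑ i, θ (x i) ^ 2 / σ i ^ 2) / 2) *
      (2 * Real.sinh (∑ i, θ (x i) / σ i ^ 2 * y i)))) =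
      fun y => g θ y * δ y - g (-θ) y * δ y := by
    funext y
    simp only [hg, Pi.neg_apply, neg_sq, neg_div, neg_mul, Finset.sum_neg_distrib]
    simp only [sub_eq_add_neg, Real.exp_add, Real.sinh_eq]
    ring
  rw [hpt]
  exact ⟨(hI θ).sub (hI (-θ)), by rw [integral_sub (hI θ) (hI (-θ)), hE θ, hE (-θ)]⟩

/-- The likelihood ratio test of `θ` against `-θ` maximises `E_θ δ - E_{-θ} δ`, and is the
unique maximiser when the data are informative. -/
theorem likelihoodRatio_optimal (hσ : ∀ i, 0 < σ i) (θ : EuclideanSpace ℝ (Fin d) → ℝ)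
    (hδ : IsDecisionRule δ) {w : Fin n → ℝ} (hw : ∀ i, w i = θ (x i) / σ i ^ 2) :
    (∫ y, δ y ∂dataLaw x σ θ - ∫ y, δ y ∂dataLaw x σ (-θ) ≤
      ∫ y, thresholdRule w 0 y ∂dataLaw x σ θ - ∫ y, thresholdRule w 0 y ∂dataLaw x σ (-θ)) ∧
    (0 < √(∑ i, w i ^ 2 * σ i ^ 2) →
      ∫ y, thresholdRule w 0 y ∂dataLaw x σ θ - ∫ y, thresholdRule w 0 y ∂dataLaw x σ (-θ) ≤
        ∫ y, δ y ∂dataLaw x σ θ - ∫ y, δ y ∂dataLaw x σ (-θ) →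
      ∀ θ', ∀ᵐ y ∂dataLaw x σ θ', δ y = thresholdRule w 0 y) := by
  obtain ⟨hI1, hE1⟩ := integral_sub_integral_neg (x := x) hσ θ hδ
  obtain ⟨hI2, hE2⟩ := integral_sub_integral_neg (x := x) hσ θ (isDecisionRule_thresholdRule w 0)
  rw [hE1, hE2]
  simp_rw [← hw] at hI1 hI2 ⊢
  set c := Real.exp (-(∑ i, θ (x i) ^ 2 / σ i ^ 2) / 2)
  have hc : 0 < c := Real.exp_pos _
  have hpt : ∀ y, δ y * (c * (2 * Real.sinh (∑ i, w i * y i))) ≤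
      thresholdRule w 0 y * (c * (2 * Real.sinh (∑ i, w i * y i))) := fun y => by
    rw [thresholdRule_zero]
    split_ifs with h
    · exact mul_le_mul_of_nonneg_right (hδ.2 y).2
        (mul_nonneg hc.le (mul_nonneg zero_le_two (Real.sinh_nonneg_iff.2 h)))
    · rw [zero_mul]
      exact mul_nonpos_of_nonneg_of_nonpos (hδ.2 y).1 (mul_nonpos_of_nonneg_of_nonpos hc.le
        (by linarith [Real.sinh_neg_iff.2 (not_le.1 h)]))
  refine ⟨integral_mono hI1 hI2 hpt, fun hτ hge θ' => ?_⟩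
  have hae : (fun y => δ y * (c * (2 * Real.sinh (∑ i, w i * y i)))) =ᵐ[dataLaw x σ 0]
      fun y => thresholdRule w 0 y * (c * (2 * Real.sinh (∑ i, w i * y i))) :=
    (integral_eq_iff_of_ae_le hI1 hI2 (ae_of_all _ hpt)).1
      (le_antisymm (integral_mono hI1 hI2 hpt) hge)
  have hne : ∀ᵐ y ∂dataLaw x σ 0, ∑ i, w i * y i ≠ 0 := by
    have hna := nullSingletonClass_gaussianReal_sq (μ := ∑ i, w i * (0 : ℝ)) hτ
    have h1 : ∀ᵐ z ∂(dataLaw x σ 0).map (fun y => ∑ i, w i * y i), z ≠ 0 := by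
      rw [map_dataLaw]
      exact compl_mem_ae_iff.2 (measure_singleton 0)
    have hm : Measurable fun y : EuclideanSpace ℝ (Fin n) => ∑ i, w i * y i := by fun_prop
    exact ae_of_ae_map hm.aemeasurable h1
  have h0 : ∀ᵐ y ∂dataLaw x σ 0, δ y = thresholdRule w 0 y := by
    filter_upwards [hae, hne] with y h1 h2
    refine mul_right_cancel₀ (mul_ne_zero hc.ne' (mul_ne_zero two_ne_zero ?_)) h1
    exact fun h => h2 (Real.sinh_eq_zero.1 h)
  rw [dataLaw_eq_withDensity hσ θ']
  exact (withDensity_absolutelyContinuous _ _).ae_le h0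

end Minimax

section Cases

variable {d n : ℕ} [NeZero n] {C : NNReal} {x₀ : EuclideanSpace ℝ (Fin d)}
  {x : Fin n → EuclideanSpace ℝ (Fin d)} {σ : Fin n → ℝ} {δ : EuclideanSpace ℝ (Fin n) → ℝ}

/-! ### Small bias of the nearest signal -/

/-- A solution `m` of the fixed point equation is a critical point of `M Φ(-(M - k) / τ)`, the worst
regret of the matching linear rule at the welfare contrast `M`. Here `k` is the largest bias of the
normalised linear statistic, `τ` is its standard deviation and `(m - k) / τ` is `s(m)`. -/
theorem fixedPoint_tail (hσ : ∀ i, 0 < σ i) {m : ℝ} (hm : C * ‖x 0 - x₀‖ < m)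
    (hfp : FixedPointEq C x₀ x σ m) {A k τ : ℝ} (hA : A = ∑ j, excess C x₀ x m j / σ j ^ 2)
    (hk : k = (∑ j, excess C x₀ x m j / σ j ^ 2 * (C * ‖x j - x₀‖)) / A)
    (hτ : τ = snr C x₀ x σ m / A) :
    LogConcaveTail (fun t => stdCdf (-(t / τ))) (fun t => stdPdf (t / τ) / τ) ∧
      (m - k) / τ = snr C x₀ x σ m ∧
      stdCdf (-((m - k) / τ)) = m * (stdPdf ((m - k) / τ) / τ) := by
  have hApos : 0 < A := hA ▸ sum_excess_pos hσ hm
  have hs : 0 < snr C x₀ x σ m := snr_pos hσ hm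
  have hτpos : 0 < τ := hτ ▸ div_pos hs hApos
  have h1 : (m - k) / τ = snr C x₀ x σ m := by
    have h2 := sum_excess_mul_sub (C := C) (x₀ := x₀) (x := x) (σ := σ) m
    simp_rw [mul_sub] at h2
    rw [Finset.sum_sub_distrib, ← Finset.sum_mul, ← hA] at h2
    have h3 : k * A = ∑ j, excess C x₀ x m j / σ j ^ 2 * (C * ‖x j - x₀‖) := by
      rw [hk, div_mul_cancel₀ _ hApos.ne']
    rw [hτ, div_div_eq_mul_div, div_eq_iff hs.ne', sub_mul, h3]
    linarith
  refine ⟨logConcaveTail_normal.comp_div hτpos, h1, ?_⟩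
  rw [h1, hτ, div_div_eq_mul_div, ← mul_div_assoc, eq_div_iff hs.ne',
    (fixedPointEq_iff hσ hm).1 hfp, ← hA]
  ring

/-- The Bayes risk `m Φ(-s(m))` of the symmetric two-point prior on `cone C x₀ m` and its negative
has a strict global maximum at a solution of the fixed point equation. -/
theorem bayesRisk_lt_of_fixedPoint (hσ : ∀ i, 0 < σ i) {m m' : ℝ} (hm : C * ‖x 0 - x₀‖ < m)
    (hfp : FixedPointEq C x₀ x σ m) (hm' : C * ‖x 0 - x₀‖ < m') (hne : m' ≠ m) :
    m' * stdCdf (-snr C x₀ x σ m') < m * stdCdf (-snr C x₀ x σ m) := by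
  obtain ⟨hF, hs, hcrit⟩ := fixedPoint_tail hσ hm hfp rfl rfl rfl
  have h1 := hF.mul_lt hcrit hne
  simp only [hs] at h1
  refine lt_of_le_of_lt (mul_le_mul_of_nonneg_left (stdCdf_strictMono.monotone ?_) ?_) h1
  · refine neg_le_neg ?_
    have hA := sum_excess_pos (x₀ := x₀) (x := x) hσ hm
    have hspos := snr_pos (x₀ := x₀) (x := x) hσ hm
    rw [div_div_eq_mul_div, sub_mul, div_mul_cancel₀ _ hA.ne', div_le_iff₀ hspos, Finset.mul_sum,
      ← Finset.sum_sub_distrib]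
    calc ∑ j, (m' * (excess C x₀ x m j / σ j ^ 2) -
          excess C x₀ x m j / σ j ^ 2 * (C * ‖x j - x₀‖))
        ≤ ∑ j, excess C x₀ x m' j / σ j * (excess C x₀ x m j / σ j) := by
          refine Finset.sum_le_sum fun j _ => ?_
          have h2 := mul_le_mul_of_nonneg_left (sub_le_excess (C := C) (x₀ := x₀) (x := x) m' j)
            (div_nonneg (excess_nonneg (C := C) (x₀ := x₀) (x := x) m j) (sq_nonneg (σ j)))
          have h3 : excess C x₀ x m' j / σ j * (excess C x₀ x m j / σ j) =
            excess C x₀ x m j / σ j ^ 2 * excess C x₀ x m' j := by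
            have := (hσ j).ne'
            field_simp
          rw [h3]; linarith
      _ ≤ snr C x₀ x σ m' * snr C x₀ x σ m := by
          have := Real.sum_mul_le_sqrt_mul_sqrt Finset.univ (fun j => excess C x₀ x m' j / σ j)
            (fun j => excess C x₀ x m j / σ j)
          simp only [div_pow] at this
          exact this
  · exact (by positivity : 0 ≤ C * ‖x 0 - x₀‖).trans hm'.le

theorem thresholdRule_weights (hσ : ∀ i, 0 < σ i) {m : ℝ} (hm : C * ‖x 0 - x₀‖ < m) :
    thresholdRule (weights C x₀ x σ m) 0 =
      thresholdRule (fun j => excess C x₀ x m j / σ j ^ 2) 0 := by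
  have hc : 0 < (m - C * ‖x 0 - x₀‖) / σ 0 ^ 2 := div_pos (sub_pos.2 hm) (pow_pos (hσ 0) 2)
  have hw : ∀ j, weights C x₀ x σ m j =
      (excess C x₀ x m j / σ j ^ 2) / ((m - C * ‖x 0 - x₀‖) / σ 0 ^ 2) := fun j => by
    rw [weights]
    split_ifs with hj
    · rw [hj, excess_of_le hm.le, div_self hc.ne']
    · rfl
  funext y
  rw [thresholdRule_zero, thresholdRule_zero]
  simp_rw [hw, div_mul_eq_mul_div _ ((m - C * ‖x 0 - x₀‖) / σ 0 ^ 2)]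
  rw [← Finset.sum_div]
  congr 1
  exact propext ⟨fun h => by simpa using (le_div_iff₀ hc).1 h, fun h => div_nonneg h hc.le⟩

/-- The linear rule of a fixed point attains the Bayes risk `m Φ(-s(m))` as its maximal regret, so
every minimax rule is a Bayes rule and hence agrees with it. -/
theorem isMMR_thresholdRule (hσ : ∀ i, 0 < σ i) {m : ℝ} (hm : C * ‖x 0 - x₀‖ < m)
    (hfp : FixedPointEq C x₀ x σ m) :
    IsMMR C x₀ x σ (thresholdRule (weights C x₀ x σ m) 0) ∧
      ∀ δ, IsMMR C x₀ x σ δ → ∀ θ : EuclideanSpace ℝ (Fin d) → ℝ,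
        ∀ᵐ y ∂(dataLaw x σ θ), δ y = thresholdRule (weights C x₀ x σ m) 0 y := by
  rw [thresholdRule_weights hσ hm]
  obtain ⟨hF, hsm, hcrit⟩ := fixedPoint_tail hσ hm hfp rfl rfl rfl
  set w : Fin n → ℝ := fun j => excess C x₀ x m j / σ j ^ 2 with hw
  set s := snr C x₀ x σ m with hs
  have hm0 : 0 < m := (by positivity : 0 ≤ C * ‖x 0 - x₀‖).trans_lt hm
  have hspos : 0 < s := snr_pos hσ hm
  have hA : 0 < ∑ j, w j := sum_excess_pos hσ hm
  have hws : √(∑ i, w i ^ 2 * σ i ^ 2) = s := by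
    rw [hs, snr]
    congr 1
    refine Finset.sum_congr rfl fun j _ => ?_
    have := (hσ j).ne'
    simp only [hw]
    field_simp
  have hE : ∀ θ : EuclideanSpace ℝ (Fin d) → ℝ, ∫ y, thresholdRule w 0 y ∂dataLaw x σ θ =
      stdCdf ((∑ i, w i * θ (x i)) / s) := fun θ => by
    have := integral_threshold_dataLaw (x := x) (hws ▸ hspos) 0 θ
    rwa [hws, sub_zero, EReal.coe_zero] at this
  -- The upper bound for the linear rule.
  have hle : ∀ θ ∈ Params d C, regret x₀ x σ (thresholdRule w 0) θ ≤ m * stdCdf (-s) := by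
    intro θ hθ
    rw [← hsm]
    refine regret_le_of_tail hF (fun t => ?_) hcrit (l := (∑ i, w i * θ (x i)) / ∑ i, w i) ?_ ?_
    · rw [neg_div, stdCdf_neg]
    · have h1 : (∑ i, w i * θ (x i)) / (∑ i, w i) - θ x₀ =
          (∑ i, w i * (θ (x i) - θ x₀)) / ∑ i, w i := by
        simp_rw [mul_sub]
        rw [Finset.sum_sub_distrib, ← Finset.sum_mul, sub_div, mul_div_cancel_left₀ _ hA.ne']
      rw [h1, abs_div, abs_of_pos hA]
      refine div_le_div_of_nonneg_right ((Finset.abs_sum_le_sum_abs _ _).trans ?_) hA.le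
      refine Finset.sum_le_sum fun j _ => ?_
      have hwj : 0 ≤ w j := div_nonneg (excess_nonneg m j) (sq_nonneg _)
      rw [abs_mul, abs_of_nonneg hwj]
      exact mul_le_mul_of_nonneg_left (abs_sub_le_of_mem_params hθ (x j)) hwj
    · rw [hE, ← stdCdf_neg, neg_neg, div_div_div_cancel_right₀ hA.ne']
  -- The lower bound from the two-point prior on `cone C x₀ m` and its negative.
  have hw' : ∀ i, w i = cone C x₀ m (x i) / σ i ^ 2 := fun i => rfl
  have hx0 : cone C x₀ m x₀ = m := cone_apply_center hm0.le
  have hgain : ∫ y, thresholdRule w 0 y ∂dataLaw x σ (cone C x₀ m) -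
      ∫ y, thresholdRule w 0 y ∂dataLaw x σ (-cone C x₀ m) = 1 - 2 * stdCdf (-s) := by
    have h1 : ∑ i, w i * cone C x₀ m (x i) = s * s := by
      rw [← sq, hs, snr_sq]
      exact Finset.sum_congr rfl fun j _ => by
        rw [cone_apply, div_mul_eq_mul_div, ← sq]
    simp only [hE, Pi.neg_apply, mul_neg, Finset.sum_neg_distrib, h1, neg_div,
      mul_div_cancel_right₀ _ hspos.ne', stdCdf_neg]
    ring
  have hsum : ∀ δ : EuclideanSpace ℝ (Fin n) → ℝ, regret x₀ x σ δ (cone C x₀ m) +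
      regret x₀ x σ δ (-cone C x₀ m) = m * (1 - (∫ y, δ y ∂dataLaw x σ (cone C x₀ m) -
        ∫ y, δ y ∂dataLaw x σ (-cone C x₀ m))) := fun δ => by
    rw [regret_add_regret_neg (hx0.symm ▸ hm0), hx0]
  refine ⟨isMMR_of_le (isDecisionRule_thresholdRule w 0) hle fun δ hδ => ?_, fun δ hδ => ?_⟩
  · refine le_maxRegret_of_two_point (cone_mem_params x₀ m) ?_
    have h1 := (likelihoodRatio_optimal hσ (cone C x₀ m) hδ hw').1
    rw [hsum]
    nlinarith
  · refine (likelihoodRatio_optimal hσ (cone C x₀ m) hδ.1 hw').2 (hws ▸ hspos) ?_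
    have h1 := hδ.regret_le (isDecisionRule_thresholdRule w 0) hle
    have h2 := add_le_add (h1 _ (cone_mem_params x₀ m))
      (h1 _ (neg_mem_params (cone_mem_params x₀ m)))
    rw [hsum] at h2
    rw [hgain]
    have h3 : m * (1 - (∫ y, δ y ∂dataLaw x σ (cone C x₀ m) -
        ∫ y, δ y ∂dataLaw x σ (-cone C x₀ m))) ≤ m * (2 * stdCdf (-s)) := by linarith
    linarith [le_of_mul_le_mul_left h3 hm0]

/-! ### Large bias of the nearest signal -/

theorem cone_bias_apply (hx : Monotone fun i => ‖x i - x₀‖) (i : Fin n) :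
    cone C x₀ (C * ‖x 0 - x₀‖) (x i) = 0 := by
  rw [cone_apply]
  exact excess_of_ge (mul_le_mul_of_nonneg_left (hx (Fin.zero_le i)) C.coe_nonneg)

/-- All signals can be uninformative about a welfare contrast of size `C ‖x₁ - x₀‖`. -/
theorem half_bias_le_maxRegret (hx : Monotone fun i => ‖x i - x₀‖)
    (hk : 0 < C * ‖x 0 - x₀‖) :
    ((C * ‖x 0 - x₀‖ / 2 : ℝ) : EReal) ≤ maxRegret C x₀ x σ δ := by
  have hx0 := cone_apply_center (C := C) (x₀ := x₀) hk.le
  have hz := cone_bias_apply (C := C) hx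
  have hz' : ∀ i, (-cone C x₀ (C * ‖x 0 - x₀‖)) (x i) = 0 := fun i => by
    rw [Pi.neg_apply, hz i, neg_zero]
  refine le_maxRegret_of_two_point (cone_mem_params x₀ (C * ‖x 0 - x₀‖)) ?_
  rw [regret_add_regret_neg (hx0.symm ▸ hk), hx0, dataLaw_of_forall_eq_zero hz,
    dataLaw_of_forall_eq_zero hz', sub_self]
  linarith

/-- A rule that responds to the first signal alone has maximal regret at most half the bias if its
tail has density `1 / (2 C ‖x₁ - x₀‖)` at zero. -/
theorem regret_le_half_bias {F f : ℝ → ℝ} (hF : LogConcaveTail F f)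
    (hsymm : ∀ t, F (-t) = 1 - F t) (hf : C * ‖x 0 - x₀‖ * f 0 = 1 / 2)
    (hδ : ∀ θ : EuclideanSpace ℝ (Fin d) → ℝ, ∫ y, δ y ∂dataLaw x σ θ = 1 - F (θ (x 0))) :
    ∀ θ ∈ Params d C, regret x₀ x σ δ θ ≤ C * ‖x 0 - x₀‖ / 2 := by
  intro θ hθ
  have hF0 : F 0 = 1 / 2 := by
    have := hsymm 0
    rw [neg_zero] at this; linarith
  have h1 := regret_le_of_tail (x := x) (σ := σ) hF hsymm (k := C * ‖x 0 - x₀‖)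
    (m := C * ‖x 0 - x₀‖) (by rw [sub_self, hF0, hf])
    (abs_sub_le_of_mem_params hθ (x 0)) (hδ θ)
  rw [sub_self, hF0] at h1
  linarith

theorem measurable_clip (ρ : ℝ) :
    Measurable fun y : ℝ => if y < -ρ then 0 else if y ≤ ρ then (y + ρ) / (2 * ρ) else 1 :=
  Measurable.ite measurableSet_Iio measurable_const
    (Measurable.ite measurableSet_Iic (by fun_prop) measurable_const)

theorem isDecisionRule_linearRule {ρ : ℝ} (hρ : 0 < ρ) :
    IsDecisionRule (linearRule ρ : EuclideanSpace ℝ (Fin n) → ℝ) := by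
  refine ⟨(measurable_clip ρ).comp (by fun_prop : Measurable fun y : EuclideanSpace ℝ (Fin n) =>
    y 0), fun y => ?_⟩
  unfold linearRule
  split_ifs with h1 h2
  · simp
  · exact ⟨div_nonneg (by linarith) (by linarith), (div_le_one (by linarith)).2 (by linarith)⟩
  · simp

theorem isDecisionRule_probitRule : IsDecisionRule (probitRule C x₀ x σ) := by
  refine ⟨?_, fun y => ⟨(stdCdf_pos _).le, stdCdf_le_one _⟩⟩
  unfold probitRule
  exact continuous_stdCdf.measurable.comp (by fun_prop)

theorem regret_signRule_le (hσ : ∀ i, 0 < σ i)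
    (hk : C * ‖x 0 - x₀‖ = √(Real.pi / 2) * σ 0) :
    ∀ θ ∈ Params d C, regret x₀ x σ (fun y => if 0 ≤ y 0 then 1 else 0) θ ≤
      C * ‖x 0 - x₀‖ / 2 := by
  refine regret_le_half_bias (logConcaveTail_normal.comp_div (hσ 0)) (fun t => ?_) ?_ fun θ => ?_
  · rw [neg_div, stdCdf_neg]
  · rw [hk, zero_div, ← stdPdf_zero_mul_sqrt]
    have := (hσ 0).ne'
    field_simp
  · rw [integral_comp_apply_dataLaw 0 θ (g := fun y => if 0 ≤ y then 1 else 0)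
      (Measurable.ite measurableSet_Ici measurable_const measurable_const),
      integral_threshold_gaussianReal (hσ 0), sub_zero, stdCdf_neg]
    ring

theorem regret_linearRule_le (hσ : ∀ i, 0 < σ i) {ρ : ℝ} (hρ : 0 < ρ)
    (hfix : ρ = C * ‖x 0 - x₀‖ * (1 - 2 * stdCdf (-ρ / σ 0))) :
    ∀ θ ∈ Params d C, regret x₀ x σ (linearRule ρ) θ ≤ C * ‖x 0 - x₀‖ / 2 := by
  have hb : 0 < ρ / σ 0 := div_pos hρ (hσ 0)
  refine regret_le_half_bias ((logConcaveTail_smooth hb).comp_div (hσ 0)) (fun t => ?_) ?_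
    fun θ => ?_
  · rw [neg_div, smoothTail_neg hb]
  · have h1 : smoothDens (ρ / σ 0) 0 = (1 - 2 * stdCdf (-ρ / σ 0)) / (2 * (ρ / σ 0)) := by
      rw [smoothDens, sub_zero, sub_zero, neg_div, stdCdf_neg]
      ring
    rw [zero_div, h1, div_div, ← mul_div_assoc, ← hfix]
    have := (hσ 0).ne'
    field_simp
  · exact (integral_comp_apply_dataLaw 0 θ (measurable_clip ρ)).trans
      (integral_clip_gaussianReal (hσ 0) hρ)

theorem regret_probitRule_le (hσ : ∀ i, 0 < σ i)
    (hk : √(Real.pi / 2) * σ 0 < C * ‖x 0 - x₀‖) :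
    ∀ θ ∈ Params d C, regret x₀ x σ (probitRule C x₀ x σ) θ ≤ C * ‖x 0 - x₀‖ / 2 := by
  set k := C * ‖x 0 - x₀‖ with hkdef
  have hσ0 := hσ 0
  have hpi : 0 < √(Real.pi / 2) := Real.sqrt_pos.2 (by positivity)
  have hpi2 : √(Real.pi / 2) ^ 2 = Real.pi / 2 := Real.sq_sqrt (by positivity)
  have hk0 : 0 < k := lt_of_le_of_lt (by positivity) hk
  set v := 2 * (C : ℝ) ^ 2 * ‖x 0 - x₀‖ ^ 2 / Real.pi - σ 0 ^ 2 with hv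
  have hv' : v = (k / √(Real.pi / 2)) ^ 2 - σ 0 ^ 2 := by
    rw [hv, div_pow, hpi2, hkdef]
    field_simp
  have hlt : σ 0 < k / √(Real.pi / 2) := by rwa [lt_div_iff₀ hpi, mul_comm]
  have hvpos : 0 < v := by rw [hv']; nlinarith
  have hτ : √(σ 0 ^ 2 + √v ^ 2) = k / √(Real.pi / 2) := by
    rw [Real.sq_sqrt hvpos.le, hv', add_sub_cancel, Real.sqrt_sq (by positivity)]
  refine regret_le_half_bias
    (logConcaveTail_normal.comp_div (τ := k / √(Real.pi / 2)) (by positivity)) (fun t => ?_) ?_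
    fun θ => ?_
  · rw [neg_div, stdCdf_neg]
  · rw [zero_div, ← stdPdf_zero_mul_sqrt, ← hkdef]
    field_simp
  · have h1 := integral_comp_apply_dataLaw (x := x) (σ := σ) 0 θ
      (g := fun y => stdCdf (y / √v)) (continuous_stdCdf.measurable.comp (by fun_prop))
    rw [integral_stdCdf_gaussianReal (Real.sqrt_pos.2 hvpos), hτ] at h1
    rw [stdCdf_neg, sub_sub_cancel, ← h1]
    rfl

end Cases

/-! ### Suboptimality of linear threshold rules -/

section NoThreshold

variable {d n : ℕ} {C : NNReal} {x₀ : EuclideanSpace ℝ (Fin d)}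
  {x : Fin n → EuclideanSpace ℝ (Fin d)} {σ : Fin n → ℝ}

theorem integral_thresholdRule_of_eq_zero {w : Fin n → ℝ} (hw : ∀ i, w i = 0) (c : EReal)
    (μ : Measure (EuclideanSpace ℝ (Fin n))) [IsProbabilityMeasure μ] :
    ∫ y, thresholdRule w c y ∂μ = if c ≤ 0 then 1 else 0 := by
  simp [thresholdRule, hw]

variable [NeZero n]

/-- Among the data compatible with the welfare contrast `C ‖x₁ - x₀‖`, every coordinate but the
first can be perturbed in both directions away from zero, the others being zero. -/
theorem exists_perturbation (hC : 0 < C) (hx_inj : Function.Injective x)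
    (hx_mono : Monotone fun i => ‖x i - x₀‖)
    (hx_unique : ∀ i, i ≠ 0 → ‖x 0 - x₀‖ < ‖x i - x₀‖) {j : Fin n} (hj : j ≠ 0) :
    ∃ ε > 0, ∃ θ₁ ∈ Params d C, ∃ θ₂ ∈ Params d C,
      (θ₁ x₀ = C * ‖x 0 - x₀‖ ∧ θ₁ (x j) = ε ∧ ∀ i, i ≠ j → θ₁ (x i) = 0) ∧
      (θ₂ x₀ = C * ‖x 0 - x₀‖ ∧ θ₂ (x j) = -ε ∧ ∀ i, i ≠ j → θ₂ (x i) = 0) := by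
  have hC' : (0 : ℝ) < C := hC
  set k := C * ‖x 0 - x₀‖ with hkdef
  have hk0 : 0 ≤ k := by positivity
  obtain ⟨ε, ⟨hε1, hε2⟩, hε⟩ : ∃ ε : ℝ, (ε < C * ‖x j - x₀‖ - k ∧
      ∀ i, i ≠ j → ε < C * ‖x i - x j‖) ∧ 0 < ε := by
    have e1 : ∀ᶠ ε in 𝓝 (0 : ℝ), ε < C * ‖x j - x₀‖ - k :=
      gt_mem_nhds (sub_pos.2 (mul_lt_mul_of_pos_left (hx_unique j hj) hC'))
    have e2 : ∀ᶠ ε in 𝓝 (0 : ℝ), ∀ i, i ≠ j → ε < C * ‖x i - x j‖ := by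
      refine eventually_all.2 fun i => ?_
      by_cases hij : i = j
      · simp [hij]
      · filter_upwards [gt_mem_nhds (mul_pos hC' (norm_pos_iff.2
          (sub_ne_zero.2 (hx_inj.ne hij))))] with ε h _ using h
    exact (((e1.and e2).filter_mono nhdsWithin_le_nhds).and
      (self_mem_nhdsWithin (s := Ioi (0 : ℝ)))).exists
  have hcone : ∀ i, cone C x₀ k (x i) = 0 := cone_bias_apply hx_mono
  have hcone0 : cone C x₀ k x₀ = k := cone_apply_center hk0
  have hL : LipschitzWith C (cone C x₀ k) := cone_mem_params x₀ k
  refine ⟨ε, hε, fun y => max (cone C x₀ k y) (ε - C * ‖y - x j‖), ?_,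
    fun y => min (cone C x₀ k y) (C * ‖y - x j‖ - ε), ?_, ⟨?_, ?_, fun i hi => ?_⟩,
    ⟨?_, ?_, fun i hi => ?_⟩⟩
  · have := hL.max (lipschitzWith_sub_mul_norm_sub C ε (x j))
    rwa [max_self] at this
  · have h1 : LipschitzWith C fun y => C * ‖y - x j‖ - ε := by
      have := (lipschitzWith_mul_norm_sub C (x j)).sub (LipschitzWith.const ε)
      rwa [add_zero] at this
    have := hL.min h1
    rwa [max_self] at this
  · beta_reduce
    rw [hcone0, norm_sub_rev]
    exact max_eq_left (by linarith)
  · beta_reduce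
    rw [hcone, sub_self, norm_zero, mul_zero, sub_zero]
    exact max_eq_right hε.le
  · beta_reduce
    rw [hcone]
    exact max_eq_left (by linarith [hε2 i hi])
  · beta_reduce
    rw [hcone0, norm_sub_rev]
    exact min_eq_left (by linarith)
  · beta_reduce
    rw [hcone, sub_self, norm_zero, mul_zero, zero_sub]
    exact min_eq_right (by linarith)
  · beta_reduce
    rw [hcone]
    exact min_eq_left (by linarith [hε2 i hi])

/-- With a large bias, the maximal regret of every linear threshold rule exceeds half the bias. -/
theorem not_threshold_regret_le (hσ : ∀ i, 0 < σ i) (hx_inj : Function.Injective x)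
    (hx_mono : Monotone fun i => ‖x i - x₀‖)
    (hx_unique : ∀ i, i ≠ 0 → ‖x 0 - x₀‖ < ‖x i - x₀‖)
    (hk : √(Real.pi / 2) * σ 0 < C * ‖x 0 - x₀‖) (w : Fin n → ℝ) (c : EReal)
    (hle : ∀ θ ∈ Params d C, regret x₀ x σ (thresholdRule w c) θ ≤ C * ‖x 0 - x₀‖ / 2) :
    False := by
  have hσ0 := hσ 0
  have hk0 : 0 < C * ‖x 0 - x₀‖ := lt_of_le_of_lt (by positivity) hk
  have hC : 0 < C := by
    refine pos_iff_ne_zero.2 fun h => ?_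
    simp [h] at hk0
  set k := C * ‖x 0 - x₀‖ with hkdef
  -- Without information the rule must treat with probability one half.
  have hhalf : ∫ y, thresholdRule w c y ∂dataLaw x σ 0 = 1 / 2 := by
    have hx0 : cone C x₀ k x₀ = k := cone_apply_center hk0.le
    have hz : ∀ i, cone C x₀ k (x i) = 0 := cone_bias_apply hx_mono
    have hz' : ∀ i, (-cone C x₀ k) (x i) = 0 := fun i => by
      rw [Pi.neg_apply, hz i, neg_zero]
    have h1 := hle _ (cone_mem_params x₀ k)
    have h2 := hle _ (neg_mem_params (cone_mem_params x₀ k))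
    rw [regret_of_pos (hx0.symm ▸ hk0), hx0, dataLaw_of_forall_eq_zero hz] at h1
    rw [regret, if_neg (by simp only [Pi.neg_apply, hx0]; linarith), Pi.neg_apply, hx0,
      dataLaw_of_forall_eq_zero hz'] at h2
    set e := ∫ y, thresholdRule w c y ∂dataLaw x σ 0
    have h3 : k * (1 / 2) ≤ k * e := by linarith
    have h4 : k * e ≤ k * (1 / 2) := by linarith
    exact le_antisymm (le_of_mul_le_mul_left h4 hk0) (le_of_mul_le_mul_left h3 hk0)
  -- Hence the rule is not constant, and its threshold is zero.
  have hτ : 0 < √(∑ i, w i ^ 2 * σ i ^ 2) := by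
    rw [Real.sqrt_pos]
    refine lt_of_le_of_ne (Finset.sum_nonneg fun i _ => by positivity) fun h => ?_
    have hw : ∀ i, w i = 0 := fun i => by
      have h1 := (Finset.sum_eq_zero_iff_of_nonneg (fun i _ => by positivity)).1 h.symm i
        (Finset.mem_univ i)
      have h2 := (hσ i).ne'
      simpa [h2] using h1
    rw [integral_thresholdRule_of_eq_zero hw] at hhalf
    split_ifs at hhalf <;> norm_num at hhalf
  set τ := √(∑ i, w i ^ 2 * σ i ^ 2) with hτdef
  obtain rfl : c = (0 : ℝ) := by
    induction c with
    | bot => simp [thresholdRule] at hhalf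
    | top => simp [thresholdRule] at hhalf
    | coe c =>
      rw [integral_threshold_dataLaw hτ, ← stdCdf_zero] at hhalf
      have h1 := stdCdf_strictMono.injective hhalf
      rw [← hτdef, div_eq_zero_iff] at h1
      simp only [Pi.zero_apply, mul_zero, Finset.sum_const_zero, zero_sub, neg_eq_zero,
        hτ.ne', or_false] at h1
      rw [h1]
  have hreg : ∀ θ ∈ Params d C, 0 < θ x₀ →
      θ x₀ * stdCdf (-((∑ i, w i * θ (x i)) / τ)) ≤ k / 2 := fun θ hθ h0 => by
    have h1 := hle θ hθ
    rwa [regret_of_pos h0, integral_threshold_dataLaw hτ, sub_zero, ← stdCdf_neg, ← hτdef] at h1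
  have hbad : ∀ θ ∈ Params d C, k ≤ θ x₀ → 0 ≤ ∑ i, w i * θ (x i) := fun θ hθ h0 => by
    by_contra! hneg
    have h1 := hreg θ hθ (hk0.trans_le h0)
    have h2 : 1 / 2 < stdCdf (-((∑ i, w i * θ (x i)) / τ)) := by
      rw [← stdCdf_zero]
      exact stdCdf_strictMono (neg_pos.2 (div_neg_of_neg_of_pos hneg hτ))
    nlinarith
  -- Weight on any signal but the first would be exploited by a perturbation of that signal.
  have hwj : ∀ j, j ≠ 0 → w j = 0 := fun j hj => by
    obtain ⟨ε, hε, θ₁, hθ₁, θ₂, hθ₂, ⟨h10, h1j, h1⟩, h20, h2j, h2⟩ :=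
      exists_perturbation hC hx_inj hx_mono hx_unique hj
    have h3 := hbad θ₁ hθ₁ h10.ge
    have h4 := hbad θ₂ hθ₂ h20.ge
    rw [Finset.sum_eq_single j (fun i _ hi => by rw [h1 i hi, mul_zero]) (by simp), h1j] at h3
    rw [Finset.sum_eq_single j (fun i _ hi => by rw [h2 i hi, mul_zero]) (by simp), h2j] at h4
    have h5 : 0 ≤ w j := nonneg_of_mul_nonneg_left h3 hε
    have h6 : 0 ≤ -w j := nonneg_of_mul_nonneg_left (by linarith) hε
    linarith
  have hsum : ∀ θ : EuclideanSpace ℝ (Fin d) → ℝ, ∑ i, w i * θ (x i) = w 0 * θ (x 0) := fun θ =>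
    Finset.sum_eq_single 0 (fun i _ hi => by rw [hwj i hi, zero_mul]) (by simp)
  have hτ' : τ = |w 0| * σ 0 := by
    rw [hτdef, Finset.sum_eq_single 0 (fun i _ hi => by rw [hwj i hi]; ring) (by simp),
      ← mul_pow, Real.sqrt_sq_eq_abs, abs_mul, abs_of_pos hσ0]
  have hline : ∀ M : ℝ, (fun y => M - C * ‖y - x₀‖) ∈ Params d C := fun M =>
    lipschitzWith_sub_mul_norm_sub C M x₀
  have hw0 : 0 < w 0 := by
    have h1 : w 0 ≠ 0 := fun h => by rw [hτ', h] at hτ; simp at hτ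
    have h2 := hbad _ (hline (2 * k)) (by simp only [sub_self, norm_zero]; linarith)
    rw [hsum fun y => 2 * k - C * ‖y - x₀‖] at h2
    simp only [← hkdef] at h2
    exact lt_of_le_of_ne (nonneg_of_mul_nonneg_left h2 (by linarith)) h1.symm
  -- The regret of the remaining rule `1{Y₁ ≥ 0}` at `M - C‖· - x₀‖` is `k / 2` for `M = k`, but
  -- its derivative in `M` does not vanish there.
  have hR : ∀ M : ℝ, M * stdCdf (-((M - k) / σ 0)) ≤ k * stdCdf (-((k - k) / σ 0)) := fun M => by
    rw [sub_self, zero_div, neg_zero, stdCdf_zero]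
    rcases le_or_gt M 0 with hM | hM
    · nlinarith [stdCdf_pos (-((M - k) / σ 0))]
    · have h1 := hreg _ (hline M) (by simpa using hM)
      rw [hsum fun y => M - C * ‖y - x₀‖, hτ', abs_of_pos hw0, mul_div_mul_left _ _ hw0.ne'] at h1
      simp only [sub_self, norm_zero, mul_zero, sub_zero, ← hkdef] at h1
      linarith
  have hmax : IsLocalMax (fun M => M * stdCdf (-((M - k) / σ 0))) k :=
    Eventually.of_forall hR
  have hd := hmax.hasDerivAt_eq_zero ((logConcaveTail_normal.comp_div hσ0).hasDerivAt_mul k k)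
  rw [sub_self, zero_div, neg_zero, stdCdf_zero] at hd
  have h1 := mul_lt_mul_of_pos_right hk (stdPdf_pos 0)
  have h2 : k * (stdPdf 0 / σ 0) = 1 / 2 := by linarith
  rw [← mul_div_assoc, div_eq_iff hσ0.ne'] at h2
  nlinarith [stdPdf_zero_mul_sqrt]

end NoThreshold

end EvidenceAggregation

theorem proposition1 (d n : ℕ) [NeZero n] (C : NNReal)
    (x₀ : EuclideanSpace ℝ (Fin d)) (x : Fin n → EuclideanSpace ℝ (Fin d)) (σ : Fin n → ℝ)
    (hσ : ∀ i, 0 < σ i)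
    (hx_inj : Function.Injective x)
    (hx_mono : Monotone (fun i => ‖x i - x₀‖))
    (hx_ne : x 0 ≠ x₀)
    (hx_unique : ∀ i, i ≠ 0 → ‖x 0 - x₀‖ < ‖x i - x₀‖) :
    -- (i)
    (C * ‖x 0 - x₀‖ < √(Real.pi / 2) * σ 0 →
      ∃ m : ℝ, C * ‖x 0 - x₀‖ < m ∧ FixedPointEq C x₀ x σ m ∧
        (∀ m' : ℝ, C * ‖x 0 - x₀‖ < m' → FixedPointEq C x₀ x σ m' → m' = m) ∧
        IsMMR C x₀ x σ (thresholdRule (weights C x₀ x σ m) 0) ∧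
        ∀ δ, IsMMR C x₀ x σ δ → ∀ θ ∈ Params d C,
          ∀ᵐ y ∂(dataLaw x σ θ), δ y = thresholdRule (weights C x₀ x σ m) 0 y) ∧
    -- (ii)
    (C * ‖x 0 - x₀‖ = √(Real.pi / 2) * σ 0 →
      IsMMR C x₀ x σ (fun y => if 0 ≤ y 0 then 1 else 0)) ∧
    -- (iii)
    (√(Real.pi / 2) * σ 0 < C * ‖x 0 - x₀‖ →
      ∃ ρ ∈ Set.Ioo 0 (C * ‖x 0 - x₀‖),
        ρ = C * ‖x 0 - x₀‖ * (1 - 2 * stdCdf (-ρ / σ 0)) ∧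
        (∀ ρ' ∈ Set.Ioo 0 (C * ‖x 0 - x₀‖),
          ρ' = C * ‖x 0 - x₀‖ * (1 - 2 * stdCdf (-ρ' / σ 0)) → ρ' = ρ) ∧
        IsMMR C x₀ x σ (linearRule ρ) ∧
        IsMMR C x₀ x σ (probitRule C x₀ x σ) ∧
        ∀ t ∈ Set.Icc (0 : ℝ) 1,
          IsMMR C x₀ x σ (fun y => t * linearRule ρ y + (1 - t) * probitRule C x₀ x σ y)) ∧
    -- (iv)
    (√(Real.pi / 2) * σ 0 < C * ‖x 0 - x₀‖ →
      ∀ (w : Fin n → ℝ) (c : EReal), ¬ IsMMR C x₀ x σ (thresholdRule w c)) := by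
  refine ⟨fun hk => ?_, fun hk => ?_, fun hk => ?_, fun hk w c hopt => ?_⟩
  · obtain ⟨m, hm, hfp⟩ := exists_fixedPoint hσ hx_unique hk
    obtain ⟨hopt, huniq⟩ := isMMR_thresholdRule hσ hm hfp
    refine ⟨m, hm, hfp, fun m' hm' hfp' => ?_, hopt, fun δ hδ θ _ => huniq δ hδ θ⟩
    by_contra hne
    exact lt_asymm (bayesRisk_lt_of_fixedPoint hσ hm hfp hm' hne)
      (bayesRisk_lt_of_fixedPoint hσ hm' hfp' hm (Ne.symm hne))
  · have hk0 : 0 < C * ‖x 0 - x₀‖ := by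
      rw [hk]
      exact mul_pos (Real.sqrt_pos.2 (by positivity)) (hσ 0)
    refine isMMR_of_le ⟨?_, fun y => ?_⟩ (regret_signRule_le hσ hk)
      fun δ _ => half_bias_le_maxRegret hx_mono hk0
    · exact Measurable.ite (measurableSet_le measurable_const (by fun_prop)) measurable_const
        measurable_const
    · beta_reduce
      split_ifs <;> simp
  · have hk0 : 0 < C * ‖x 0 - x₀‖ := lt_of_le_of_lt
      (mul_nonneg (Real.sqrt_nonneg _) (hσ 0).le) hk
    obtain ⟨ρ, hρ, hfix, huniq⟩ := existsUnique_linear_cutoff (hσ 0) hk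
    have hlin := regret_linearRule_le (x := x) hσ hρ.1 hfix
    have hpro := regret_probitRule_le (x := x) hσ hk
    have hrule := isDecisionRule_linearRule (n := n) hρ.1
    have hprule := isDecisionRule_probitRule (C := C) (x₀ := x₀) (x := x) (σ := σ)
    have hlow := fun (δ : EuclideanSpace ℝ (Fin n) → ℝ) (_ : IsDecisionRule δ) =>
      half_bias_le_maxRegret (σ := σ) (δ := δ) hx_mono hk0
    refine ⟨ρ, hρ, hfix, huniq, isMMR_of_le hrule hlin hlow, isMMR_of_le hprule hpro hlow,
      fun t ht => isMMR_of_le (isDecisionRule_convex hrule hprule ht) (fun θ hθ => ?_) hlow⟩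
    rw [regret_convex hrule hprule]
    nlinarith [mul_le_mul_of_nonneg_left (hlin θ hθ) ht.1,
      mul_le_mul_of_nonneg_left (hpro θ hθ) (sub_nonneg.2 ht.2)]
  · exact not_threshold_regret_le hσ hx_inj hx_mono hx_unique hk w c
      (hopt.regret_le isDecisionRule_probitRule (regret_probitRule_le hσ hk))
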